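/- Let $\mathfrak g$ be a finite-dimensional real semisimple Lie algebra with Killing form $B$ and a gradation $\mathfrak g=\bigoplus_{k\in\mathbb Z}\mathfrak g_k$, $[\mathfrak g_k,\mathfrak g_l]\subset\mathfrak g_{k+l}$. Let $Z$ be its characteristic element, i.e. the element with $\mathfrak g_k=\{X\in\mathfrak g : [Z,X]=kX\}$ for every $k\in\mathbb Z$. Let $\sigma$ be a grade-reversing Cartan involution: an involutive automorphism of $\mathfrak g$ with $\sigma(\mathfrak g_k)=\mathfrak g_{-k}$ for every $k$ such that $B_\sigma(X,Y):=-B(X,\sigma Y)$ is a positive definite inner product. Put $\mathfrak n:=\sum_{k>0}\mathfrak g_k$ and $\mathfrak p:=\{X\in\mathfrak g:\sigma X=-X\}$, and let $\mathfrak a$ be a maximal abelian subspace of $\mathfrak p$ containing $Z$. A metric Lie algebra $(\mathfrak l,\langle\,,\rangle)$ is identified with the simply connected Lie group with Lie algebra $\mathfrak l$ and the induced left-invariant Riemannian metric; its Ricci operator $\mathrm{Ric}$ is the endomorphism of $\mathfrak l$ with $\langle \mathrm{Ric}(X),Y\rangle=\mathrm{tr}(W\mapsto R(W,X)Y)$,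 where $R(X,Y)=\nabla_X\nabla_Y-\nabla_Y\nabla_X-\nabla_{[X,Y]}$ is the curvature tensor of the Levi-Civita connection $\nabla$. Its mean curvature vector is the vector $H\in[\mathfrak l,\mathfrak l]^{\perp}$ such that $\langle H,A\rangle=\mathrm{tr}(\mathrm{ad}_A)$ for every $A\in[\mathfrak l,\mathfrak l]^{\perp}$. Let $H_0\in\mathfrak a$ be the mean curvature vector of $(\mathfrak a+\mathfrak n,B_\sigma)$. Let $\mathfrak s:=\mathbb R H_0+\mathfrak n$ with the inner product $\langle\,,\rangle^2$ for which $\mathbb R H_0$ and $\mathfrak n$ are orthogonal and which equals $2B_\sigma$ on $\mathbb R H_0$ and $B_\sigma$ on $\mathfrak n$ (the solvmanifold attached to the graded Lie algebra). Let $\mathrm{Ric}$ and $\mathrm{Ric}^{\mathfrak n}$ be the Ricci operators of $(\mathfrak s,\langle\,,\rangle^2)$ and $(\mathfrak n,B_\sigma)$. Then: (1) $\mathrm{Ric}=-\tfrac14\,\mathrm{id}$ on $\mathbb R H_0+\mathfrak g_1+\mathfrak g_2$; (2) $\mathrm{Ric}(U)=\mathrm{Ric}^{\mathfrak n}(U)-\tfrac12[H_0,U]$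 for every $U\in\mathfrak n$. -/

import Mathlib

/-! ## Metric Lie algebras: left-invariant Riemannian geometry -/

/-- A positive definite inner product on a real Lie algebra `L`; equivalently, a left-invariant
Riemannian metric on the simply connected Lie group with Lie algebra `L`. -/
structure LieMetric (L : Type*) [LieRing L] [LieAlgebra ℝ L] where
  form : LinearMap.BilinForm ℝ L
  symm : ∀ x y, form x y = form y x
  posDef : ∀ x, x ≠ 0 → 0 < form x x

namespace LieMetric

variable {L : Type*} [LieRing L] [LieAlgebra ℝ L]

/-- The restriction of an inner product to a Lie subalgebra. -/
def restrict (g : LieMetric L) (K : LieSubalgebra ℝ L) : LieMetric K where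
  form := g.form.compl₁₂ K.toSubmodule.subtype K.toSubmodule.subtype
  symm x y := g.symm x y
  posDef x hx := g.posDef x (by simpa using hx)

theorem nondegenerate (g : LieMetric L) : g.form.Nondegenerate := by
  refine ⟨fun x hx => ?_, fun x hx => ?_⟩ <;>
  · by_contra h
    exact (g.posDef x h).ne' (hx x)

/-- `H` is the mean curvature vector of the metric Lie algebra `L`: it lies in the orthogonal
complement of `[L, L]`, and `⟨H, A⟩ = tr (ad A)` for every `A` in that complement. -/
def IsMeanCurvatureVector (g : LieMetric L) (H : L) : Prop :=
  (∀ x y : L, g.form H ⁅x, y⁆ = 0) ∧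
    ∀ A : L, (∀ x y : L, g.form A ⁅x, y⁆ = 0) →
      g.form H A = LinearMap.trace ℝ L (LieAlgebra.ad ℝ L A)

/-- The right-hand side of the Koszul formula for left-invariant vector fields:
`koszul x y z = (⟨[x, y], z⟩ - ⟨[y, z], x⟩ + ⟨[z, x], y⟩) / 2`. -/
noncomputable def koszul (g : LieMetric L) : L →ₗ[ℝ] L →ₗ[ℝ] Module.Dual ℝ L :=
  LinearMap.mk₂ ℝ
    (fun x y => (1 / 2 : ℝ) • (g.form ⁅x, y⁆ - (g.form x) ∘ₗ LieAlgebra.ad ℝ L y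
      - (g.form y) ∘ₗ LieAlgebra.ad ℝ L x))
    (fun x x' y => by ext z; simp; ring)
    (fun c x y => by ext z; simp; ring)
    (fun x y y' => by ext z; simp; ring)
    (fun c x y => by ext z; simp; ring)

theorem koszul_apply (g : LieMetric L) (x y z : L) :
    g.koszul x y z = (g.form ⁅x, y⁆ z - g.form ⁅y, z⁆ x + g.form ⁅z, x⁆ y) / 2 := by
  have h : ⁅z, x⁆ = -⁅x, z⁆ := (lie_skew _ _).symm
  rw [h, g.symm ⁅y, z⁆ x, map_neg, LinearMap.neg_apply, g.symm ⁅x, z⁆ y]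
  simp [koszul]
  ring

variable [Module.Finite ℝ L]

/-- The vector representing a linear functional with respect to the inner product. -/
noncomputable def sharp (g : LieMetric L) : Module.Dual ℝ L →ₗ[ℝ] L :=
  (LinearMap.BilinForm.toDual g.form g.nondegenerate).symm.toLinearMap

theorem form_sharp (g : LieMetric L) (φ : Module.Dual ℝ L) (y : L) :
    g.form (g.sharp φ) y = φ y :=
  LinearMap.BilinForm.apply_toDual_symm_apply (hB := g.nondegenerate) φ y

/-- The Levi-Civita connection of the left-invariant metric, on left-invariant vector fields. -/
noncomputable def leviCivita (g : LieMetric L) : L →ₗ[ℝ] L →ₗ[ℝ] L :=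
  g.koszul.compr₂ g.sharp

theorem form_leviCivita (g : LieMetric L) (x y z : L) :
    g.form (g.leviCivita x y) z =
      (g.form ⁅x, y⁆ z - g.form ⁅y, z⁆ x + g.form ⁅z, x⁆ y) / 2 := by
  rw [← koszul_apply]
  exact g.form_sharp _ _

/-- The curvature tensor `R(x, y) = ∇_x ∇_y - ∇_y ∇_x - ∇_[x, y]`. -/
noncomputable def curvature (g : LieMetric L) : L →ₗ[ℝ] L →ₗ[ℝ] L →ₗ[ℝ] L :=
  LinearMap.mk₂ ℝ
    (fun x y => g.leviCivita x ∘ₗ g.leviCivita y - g.leviCivita y ∘ₗ g.leviCivita x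
      - g.leviCivita ⁅x, y⁆)
    (fun x x' y => by ext z; simp; abel)
    (fun c x y => by ext z; simp [smul_sub])
    (fun x y y' => by ext z; simp; abel)
    (fun c x y => by ext z; simp [smul_sub])

/-- The Ricci tensor `Ric(x, y) = tr (z ↦ R(z, x) y)`. -/
noncomputable def ricciForm (g : LieMetric L) : LinearMap.BilinForm ℝ L :=
  LinearMap.mk₂ ℝ
    (fun x y => LinearMap.trace ℝ L ((g.curvature.flip x).flip y))
    (fun x x' y => by rw [← map_add]; congr 1; ext z; simp)
    (fun c x y => by rw [← map_smul]; congr 1; ext z; simp)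
    (fun x y y' => by rw [← map_add]; congr 1; ext z; simp)
    (fun c x y => by rw [← map_smul]; congr 1; ext z; simp)

/-- The Ricci operator, determined by `⟨Ric x, y⟩ = Ric(x, y)`. -/
noncomputable def ricci (g : LieMetric L) : L →ₗ[ℝ] L :=
  g.sharp ∘ₗ g.ricciForm

end LieMetric

/-! ## Cartan involutions and gradations -/

/-- A Cartan involution `σ`: an involutive automorphism such that the form
`B_σ(x, y) = -B(x, σ y)`, with `B` the Killing form, is positive definite. -/
structure IsCartanInvolution {𝔤 : Type*} [LieRing 𝔤] [LieAlgebra ℝ 𝔤]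
    (σ : 𝔤 ≃ₗ⁅ℝ⁆ 𝔤) : Prop where
  involutive : ∀ x, σ (σ x) = x
  pos : ∀ x, x ≠ 0 → 0 < -killingForm ℝ 𝔤 x (σ x)

namespace IsCartanInvolution

variable {𝔤 : Type*} [LieRing 𝔤] [LieAlgebra ℝ 𝔤] {σ : 𝔤 ≃ₗ⁅ℝ⁆ 𝔤}

/-- The inner product `B_σ(x, y) = -B(x, σ y)` on the whole Lie algebra. -/
noncomputable def metric (hσ : IsCartanInvolution σ) : LieMetric 𝔤 where
  form := -(killingForm ℝ 𝔤).compl₂ (σ : 𝔤 →ₗ[ℝ] 𝔤)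
  symm x y := by
    have h := LieAlgebra.killingForm_of_equiv_apply σ x (σ y)
    rw [hσ.involutive, LieModule.traceForm_comm] at h
    simp [h]
  posDef x hx := by simpa using hσ.pos x hx

end IsCartanInvolution

/-- The `(-1)`-eigenspace `𝔭` of `σ`. -/
def cartanP {𝔤 : Type*} [LieRing 𝔤] [LieAlgebra ℝ 𝔤] (σ : 𝔤 ≃ₗ⁅ℝ⁆ 𝔤) : Submodule ℝ 𝔤 where
  carrier := {x | σ x = -x}
  add_mem' {x y} hx hy := by
    simp only [Set.mem_ofPred_eq] at *
    rw [map_add, hx, hy]; abel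
  zero_mem' := by simp
  smul_mem' c x hx := by
    simp only [Set.mem_ofPred_eq] at *
    rw [map_smul, hx, smul_neg]

/-- A subspace of a Lie algebra on which the bracket vanishes. -/
def IsAbelianSubspace {𝔤 : Type*} [LieRing 𝔤] [LieAlgebra ℝ 𝔤] (𝔟 : Submodule ℝ 𝔤) : Prop :=
  ∀ x ∈ 𝔟, ∀ y ∈ 𝔟, ⁅x, y⁆ = 0

/-- `𝔞` is a maximal abelian subspace of `𝔭`. -/
structure IsMaximalAbelianIn {𝔤 : Type*} [LieRing 𝔤] [LieAlgebra ℝ 𝔤]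
    (𝔭 𝔞 : Submodule ℝ 𝔤) : Prop where
  le : 𝔞 ≤ 𝔭
  abelian : IsAbelianSubspace 𝔞
  maximal : ∀ 𝔟 : Submodule ℝ 𝔤, 𝔟 ≤ 𝔭 → IsAbelianSubspace 𝔟 → 𝔞 ≤ 𝔟 → 𝔟 = 𝔞

/-- A gradation `𝔤 = ⨁_{k ∈ ℤ} 𝔤_k` with `[𝔤_k, 𝔤_l] ⊆ 𝔤_{k+l}`. -/
structure LieGradation (𝔤 : Type*) [LieRing 𝔤] [LieAlgebra ℝ 𝔤] where
  deg : ℤ → Submodule ℝ 𝔤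
  isInternal : DirectSum.IsInternal deg
  lie_mem : ∀ (k l : ℤ) (x y : 𝔤), x ∈ deg k → y ∈ deg l → ⁅x, y⁆ ∈ deg (k + l)

namespace LieGradation

variable {𝔤 : Type*} [LieRing 𝔤] [LieAlgebra ℝ 𝔤]

/-- `Z` is the characteristic element: `𝔤_k = {x | [Z, x] = k x}` for every `k`. -/
def IsCharacteristic (G : LieGradation 𝔤) (Z : 𝔤) : Prop :=
  ∀ (k : ℤ) (x : 𝔤), x ∈ G.deg k ↔ ⁅Z, x⁆ = (k : ℝ) • x

/-- `σ` is grade-reversing: `σ(𝔤_k) = 𝔤_{-k}` for every `k`. -/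
def IsGradeReversing (G : LieGradation 𝔤) (σ : 𝔤 ≃ₗ⁅ℝ⁆ 𝔤) : Prop :=
  ∀ k : ℤ, (G.deg k).map (σ : 𝔤 →ₗ[ℝ] 𝔤) = G.deg (-k)

/-- The projection of `𝔤` onto `𝔤_0` along the sum of the other `𝔤_k`. -/
noncomputable def projZero (G : LieGradation 𝔤) : 𝔤 →ₗ[ℝ] 𝔤 :=
  (G.deg 0).subtype ∘ₗ DirectSum.component ℝ ℤ (fun k => G.deg k) 0 ∘ₗ
    (LinearEquiv.ofBijective (DirectSum.coeLinearMap G.deg) G.isInternal).symm.toLinearMap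

/-- The subspace `∑_{k > 0} 𝔤_k`. -/
def posPart (G : LieGradation 𝔤) : Submodule ℝ 𝔤 :=
  ⨆ k : {k : ℤ // 0 < k}, G.deg k

theorem deg_le_posPart (G : LieGradation 𝔤) {k : ℤ} (hk : 0 < k) : G.deg k ≤ G.posPart :=
  le_iSup (fun k : {k : ℤ // 0 < k} => G.deg k) ⟨k, hk⟩

theorem lie_mem_posPart_of_deg (G : LieGradation 𝔤) {k : ℤ} (hk : 0 ≤ k) {x u : 𝔤}
    (hx : x ∈ G.deg k) (hu : u ∈ G.posPart) : ⁅x, u⁆ ∈ G.posPart := by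
  refine Submodule.iSup_induction (fun k : {k : ℤ // 0 < k} => G.deg k)
    (motive := fun u => ⁅x, u⁆ ∈ G.posPart) hu ?_ ?_ ?_
  · intro l u hu
    exact G.deg_le_posPart (by have := l.2; omega) (G.lie_mem k l x u hx hu)
  · simp
  · intro u v hu hv
    rw [lie_add]
    exact add_mem hu hv

theorem lie_mem_posPart (G : LieGradation 𝔤) {x u : 𝔤}
    (hx : x ∈ G.posPart) (hu : u ∈ G.posPart) : ⁅x, u⁆ ∈ G.posPart := by
  refine Submodule.iSup_induction (fun k : {k : ℤ // 0 < k} => G.deg k)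
    (motive := fun x => ⁅x, u⁆ ∈ G.posPart) hx ?_ ?_ ?_
  · intro l x hx
    exact G.lie_mem_posPart_of_deg l.2.le hx hu
  · simp
  · intro x y hx hy
    rw [add_lie]
    exact add_mem hx hy

/-- The nilpotent Lie algebra `𝔫 = ∑_{k > 0} 𝔤_k`. -/
def nilpart (G : LieGradation 𝔤) : LieSubalgebra ℝ 𝔤 :=
  { G.posPart with lie_mem' := fun hx hy => G.lie_mem_posPart hx hy }

/-- The Lie algebra `𝔟 + 𝔫`, for an abelian subspace `𝔟` of `𝔤_0`. -/
def extension (G : LieGradation 𝔤) (𝔟 : Submodule ℝ 𝔤) (h0 : 𝔟 ≤ G.deg 0)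
    (hab : IsAbelianSubspace 𝔟) : LieSubalgebra ℝ 𝔤 :=
  { 𝔟 ⊔ G.posPart with
    lie_mem' := by
      intro x y hx hy
      obtain ⟨b, hb, u, hu, rfl⟩ := Submodule.mem_sup.1 hx
      obtain ⟨c, hc, v, hv, rfl⟩ := Submodule.mem_sup.1 hy
      refine Submodule.mem_sup_right ?_
      have h1 : ⁅b, v⁆ ∈ G.posPart := G.lie_mem_posPart_of_deg le_rfl (h0 hb) hv
      have h2 : ⁅u, c⁆ ∈ G.posPart := by
        rw [← lie_skew]
        exact neg_mem (G.lie_mem_posPart_of_deg le_rfl (h0 hc) hu)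
      have h3 : ⁅u, v⁆ ∈ G.posPart := G.lie_mem_posPart hu hv
      rw [add_lie, lie_add, lie_add, hab b hb c hc, zero_add]
      exact add_mem h1 (add_mem h2 h3) }

theorem posPart_le_extension (G : LieGradation 𝔤) {𝔟 : Submodule ℝ 𝔤} (h0 : 𝔟 ≤ G.deg 0)
    (hab : IsAbelianSubspace 𝔟) {x : 𝔤} (hx : x ∈ G.nilpart) : x ∈ G.extension 𝔟 h0 hab :=
  Submodule.mem_sup_right hx

theorem subspace_le_extension (G : LieGradation 𝔤) {𝔟 : Submodule ℝ 𝔤} (h0 : 𝔟 ≤ G.deg 0)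
    (hab : IsAbelianSubspace 𝔟) {x : 𝔤} (hx : x ∈ 𝔟) : x ∈ G.extension 𝔟 h0 hab :=
  Submodule.mem_sup_left hx

/-- An abelian subspace containing the characteristic element lies in `𝔤_0`. -/
theorem le_deg_zero (G : LieGradation 𝔤) {Z : 𝔤} (hZ : G.IsCharacteristic Z)
    {𝔞 : Submodule ℝ 𝔤} (hab : IsAbelianSubspace 𝔞) (hZ𝔞 : Z ∈ 𝔞) : 𝔞 ≤ G.deg 0 :=
  fun x hx => (hZ 0 x).2 (by simpa using hab Z hZ𝔞 x hx)

theorem isAbelianSubspace_span (H : 𝔤) : IsAbelianSubspace (Submodule.span ℝ {H}) := by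
  intro x hx y hy
  obtain ⟨a, rfl⟩ := Submodule.mem_span_singleton.1 hx
  obtain ⟨b, rfl⟩ := Submodule.mem_span_singleton.1 hy
  simp

/-- The Lie algebra `ℝ H + 𝔫`, for `H ∈ 𝔤_0`. -/
def lineExtension (G : LieGradation 𝔤) (H : 𝔤) (hH : H ∈ G.deg 0) : LieSubalgebra ℝ 𝔤 :=
  G.extension (Submodule.span ℝ {H})
    ((Submodule.span_singleton_le_iff_mem H (G.deg 0)).2 hH) (isAbelianSubspace_span H)

/-- The inner product `(x, y) ↦ c B_σ(x₀, y₀) + B_σ(x - x₀, y - y₀)`, where `x₀` is the component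
of `x` in `𝔤_0`. -/
noncomputable def scaledMetric (G : LieGradation 𝔤) {σ : 𝔤 ≃ₗ⁅ℝ⁆ 𝔤} (hσ : IsCartanInvolution σ)
    (c : ℝ) (hc : 0 < c) : LieMetric 𝔤 where
  form := c • hσ.metric.form.compl₁₂ G.projZero G.projZero +
    hσ.metric.form.compl₁₂ (LinearMap.id - G.projZero) (LinearMap.id - G.projZero)
  symm x y := by
    simp [hσ.metric.symm (G.projZero y), hσ.metric.symm y]
    ring
  posDef x hx := by
    have key : ∀ y, 0 ≤ hσ.metric.form y y := fun y => by
      rcases eq_or_ne y 0 with rfl | hy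
      · simp
      · exact (hσ.metric.posDef y hy).le
    change 0 < c * hσ.metric.form (G.projZero x) (G.projZero x) +
      hσ.metric.form (x - G.projZero x) (x - G.projZero x)
    rcases eq_or_ne (G.projZero x) 0 with h | h
    · rw [h]
      simpa using hσ.metric.posDef x hx
    · exact add_pos_of_pos_of_nonneg (mul_pos hc (hσ.metric.posDef _ h)) (key _)

/-- The inner product `B_σ` on `𝔫`. -/
noncomputable def nilMetric (G : LieGradation 𝔤) {σ : 𝔤 ≃ₗ⁅ℝ⁆ 𝔤} (hσ : IsCartanInvolution σ) :
    LieMetric G.nilpart :=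
  hσ.metric.restrict G.nilpart

/-- The inner product `⟨,⟩^c` on `ℝ H + 𝔫`, for which `ℝ H` and `𝔫` are orthogonal: it is `c B_σ`
on `ℝ H` and `B_σ` on `𝔫`. (The components of `t H + u`, where `u ∈ 𝔫`, along `ℝ H` and `𝔫` are
its component in `𝔤_0` and the remainder.) -/
noncomputable def lineMetric (G : LieGradation 𝔤) {σ : 𝔤 ≃ₗ⁅ℝ⁆ 𝔤} (hσ : IsCartanInvolution σ)
    (H : 𝔤) (hH : H ∈ G.deg 0) (c : ℝ) (hc : 0 < c) : LieMetric (G.lineExtension H hH) :=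
  (G.scaledMetric hσ c hc).restrict (G.lineExtension H hH)

end LieGradation

/-! Everything reduces to traces on `𝔤`. Write `P`, `M` for the projections onto the positive and
negative parts and `D` for `ad H₀` on `𝔫`.

The vector `H₀` is the Killing dual of `Y ↦ tr (ad Y ∘ P)`: this dual commutes with `𝔤_0` and is
negated by `σ`, so maximality puts it in `𝔞`, where it must equal `H₀`
(`isTraceDual_of_isMeanCurvatureVector`).

On `𝔫`, degree kills `tr (ad u)` and `tr (ad u ad v)`, and the remaining Ricci terms are `½ tr (ad
σv ad u P) - ¼ tr (ad u M ad σv P)`. Duality gives `B([H₀, u], σv) = tr (ad u ad σv P) - tr (ad σv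
ad u P)`, and `killingForm_eq_trace` gives `B(u, σv) = 2 tr (ad u ad σv P) - tr (ad u M ad σv P)`.
Eliminating the traces yields `Ric^𝔫 = -¼ + ½ D` (`ricciForm_nilMetric_of_isTraceDual`).

Adding a line `ℝ H` acting by a symmetric derivation `D` changes the Ricci form on `𝔫` by `-(tr D /
|H|²) ⟨D u, v⟩`. Here `tr D = B(H₀, H₀)` and `|H₀|² = 2 B(H₀, H₀)`, so the correction is `-½ D`.
This is (2), and it cancels the `D` term above. Since also `Ric(H₀, H₀) = -tr D² = -½ B(H₀, H₀)` and
the mixed terms vanish by degree, the whole of `ℝ H₀ + 𝔫` is Einstein with constant `-¼`, which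
contains (1). -/

namespace LinearMap

/-- Identifying `V` with its dual through `B` turns `f` into the transpose of `f'`. No symmetry of
`B` is needed, so this serves both for the metrics and for the Killing form. -/
theorem trace_eq_of_adjoint {V : Type*} [AddCommGroup V] [Module ℝ V] [Module.Finite ℝ V]
    {B : LinearMap.BilinForm ℝ V} (hB : B.Nondegenerate) {f f' : V →ₗ[ℝ] V}
    (h : ∀ x y, B (f x) y = B x (f' y)) : trace ℝ V f = trace ℝ V f' := by
  have key : (LinearMap.BilinForm.toDual B hB).conj f = f'.dualMap := by
    ext φ y
    obtain ⟨x, rfl⟩ := (LinearMap.BilinForm.toDual B hB).surjective φ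
    simp [LinearEquiv.conj_apply, LinearMap.BilinForm.toDual_def, h]
  rw [← trace_conj' f (LinearMap.BilinForm.toDual B hB), key]
  exact trace_transpose' f'

/-- The trace of an operator of nonzero weight under a derivation vanishes. -/
theorem trace_eq_zero_of_commutator {V : Type*} [AddCommGroup V] [Module ℝ V]
    [Module.Finite ℝ V] {d f : V →ₗ[ℝ] V} {c : ℝ} (hc : c ≠ 0)
    (h : d ∘ₗ f - f ∘ₗ d = c • f) : trace ℝ V f = 0 := by
  have h1 := congrArg (trace ℝ V) h
  rw [map_sub, trace_comp_comm', sub_self, map_smul, smul_eq_mul] at h1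
  exact (mul_eq_zero.1 h1.symm).resolve_left hc

end LinearMap

/-! ### Ricci form of a metric Lie algebra as traces -/

namespace LieMetric

open LinearMap (trace)

variable {L : Type*} [LieRing L] [LieAlgebra ℝ L]

theorem ext_form (g : LieMetric L) {x y : L} (h : ∀ z, g.form x z = g.form y z) : x = y := by
  rw [← sub_eq_zero]
  by_contra hne
  exact (g.posDef _ hne).ne' (by rw [map_sub g.form, LinearMap.sub_apply, h, sub_self])

section Finite

variable [Module.Finite ℝ L]

theorem leviCivita_sub (g : LieMetric L) (x y : L) :
    g.leviCivita x y - g.leviCivita y x = ⁅x, y⁆ := by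
  refine g.ext_form fun z => ?_
  rw [map_sub, LinearMap.sub_apply, form_leviCivita, form_leviCivita, ← lie_skew y x,
    ← lie_skew z x, ← lie_skew z y]
  simp only [map_neg, LinearMap.neg_apply]
  ring

theorem form_leviCivita_skew (g : LieMetric L) (x y z : L) :
    g.form (g.leviCivita x y) z = -g.form y (g.leviCivita x z) := by
  rw [g.symm y, form_leviCivita, form_leviCivita, ← lie_skew z y, ← lie_skew z x, ← lie_skew x y]
  simp only [map_neg, LinearMap.neg_apply]
  ring

theorem trace_leviCivita (g : LieMetric L) (x : L) : trace ℝ L (g.leviCivita x) = 0 := by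
  have h := LinearMap.trace_eq_of_adjoint (f := g.leviCivita x) (f' := -g.leviCivita x)
    g.nondegenerate (fun y z => by simp [form_leviCivita_skew])
  rw [map_neg] at h
  linarith

theorem leviCivita_flip (g : LieMetric L) (x : L) :
    g.leviCivita.flip x = g.leviCivita x - LieAlgebra.ad ℝ L x := by
  ext y
  rw [LinearMap.sub_apply, LieAlgebra.ad_apply, ← g.leviCivita_sub x y, LinearMap.flip_apply,
    sub_sub_cancel]

/-- The Ricci form is `-tr (N_x N_y) - tr (ad (∇_x y))`, where `N_x w = ∇_w x`. -/
theorem ricciForm_eq (g : LieMetric L) (x y : L) :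
    g.ricciForm x y = -trace ℝ L (g.leviCivita.flip x ∘ₗ g.leviCivita.flip y)
      - trace ℝ L (LieAlgebra.ad ℝ L (g.leviCivita x y)) := by
  -- Curvature as an operator in `w`: `N_{∇_x y} - ∇_x N_y + N_y ad x`. Since `N_z = ∇_z - ad z` and
  -- each `∇_z` is skew, hence traceless, only the two stated traces survive.
  have h1 : (g.curvature.flip x).flip y = g.leviCivita.flip (g.leviCivita x y)
      - g.leviCivita x ∘ₗ g.leviCivita.flip y
      + g.leviCivita.flip y ∘ₗ LieAlgebra.ad ℝ L x := by
    ext w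
    have h : ⁅w, x⁆ = -⁅x, w⁆ := (lie_skew _ _).symm
    change g.leviCivita w (g.leviCivita x y) - g.leviCivita x (g.leviCivita w y)
      - g.leviCivita ⁅w, x⁆ y = g.leviCivita w (g.leviCivita x y)
      - g.leviCivita x (g.leviCivita w y) + g.leviCivita ⁅x, w⁆ y
    rw [h, map_neg, LinearMap.neg_apply, sub_neg_eq_add]
  have h2 : g.ricciForm x y = trace ℝ L ((g.curvature.flip x).flip y) := rfl
  rw [h2, h1, map_add, map_sub, leviCivita_flip g (g.leviCivita x y), map_sub, trace_leviCivita,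
    leviCivita_flip g x, LinearMap.sub_comp, map_sub,
    LinearMap.trace_comp_comm' (LieAlgebra.ad ℝ L x)]
  ring

theorem form_ricci (g : LieMetric L) (x y : L) : g.form (g.ricci x) y = g.ricciForm x y :=
  g.form_sharp _ _

/-- The Ricci form in terms of `ad x`, its adjoint `T x` and the skew operator
`⟨J x w, z⟩ = ⟨[z, w], x⟩`. -/
theorem ricciForm_eq_of_adjoint (g : LieMetric L) {x y : L} {Tx Ty Jx Jy : L →ₗ[ℝ] L}
    (hTx : ∀ w z, g.form (Tx w) z = g.form w ⁅x, z⁆)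
    (hTy : ∀ w z, g.form (Ty w) z = g.form w ⁅y, z⁆)
    (hJx : ∀ w z, g.form (Jx w) z = g.form ⁅z, w⁆ x)
    (hJy : ∀ w z, g.form (Jy w) z = g.form ⁅z, w⁆ y) :
    g.ricciForm x y =
      -(1 / 2) * trace ℝ L (LieAlgebra.ad ℝ L x ∘ₗ LieAlgebra.ad ℝ L y)
      - (1 / 2) * trace ℝ L (Ty ∘ₗ LieAlgebra.ad ℝ L x)
      - (1 / 4) * trace ℝ L (Jx ∘ₗ Jy)
      - trace ℝ L (LieAlgebra.ad ℝ L (g.leviCivita x y)) := by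
  -- The Koszul formula read as an operator identity: `N_x = ½ (J_x - ad x - T_x)`.
  have flip_eq : ∀ {x : L} {T J : L →ₗ[ℝ] L}, (∀ w z, g.form (T w) z = g.form w ⁅x, z⁆) →
      (∀ w z, g.form (J w) z = g.form ⁅z, w⁆ x) →
      g.leviCivita.flip x = (1 / 2 : ℝ) • (J - LieAlgebra.ad ℝ L x - T) := by
    intro x T J hT hJ
    ext w
    refine g.ext_form fun z => ?_
    have h : ⁅x, w⁆ = -⁅w, x⁆ := (lie_skew _ _).symm
    simp only [LinearMap.flip_apply, form_leviCivita, LinearMap.smul_apply, LinearMap.sub_apply,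
      map_smul, map_sub, hT, hJ, LieAlgebra.ad_apply, h, map_neg, LinearMap.neg_apply,
      smul_eq_mul, g.symm w]
    ring
  have skew : ∀ {x : L} {J : L →ₗ[ℝ] L}, (∀ w z, g.form (J w) z = g.form ⁅z, w⁆ x) →
      ∀ w z, g.form w (J z) = -g.form (J w) z := by
    intro x J hJ w z
    rw [g.symm, hJ, hJ, ← lie_skew w z, map_neg, LinearMap.neg_apply]
  have adj : ∀ {f f' : L →ₗ[ℝ] L}, (∀ w z, g.form (f w) z = g.form w (f' z)) →
      trace ℝ L f = trace ℝ L f' := fun h => LinearMap.trace_eq_of_adjoint g.nondegenerate h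
  have hTx' : ∀ w z, g.form ⁅x, w⁆ z = g.form w (Tx z) := fun w z => by
    rw [g.symm, ← hTx, g.symm]
  have hTy' : ∀ w z, g.form ⁅y, w⁆ z = g.form w (Ty z) := fun w z => by
    rw [g.symm, ← hTy, g.symm]
  have e1 : trace ℝ L (Tx ∘ₗ Ty) =
      trace ℝ L (LieAlgebra.ad ℝ L x ∘ₗ LieAlgebra.ad ℝ L y) := by
    rw [LinearMap.trace_comp_comm' (LieAlgebra.ad ℝ L y) (LieAlgebra.ad ℝ L x)]
    exact adj fun w z => by simp [hTx, hTy]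
  have e2 : trace ℝ L (Tx ∘ₗ LieAlgebra.ad ℝ L y) = trace ℝ L (Ty ∘ₗ LieAlgebra.ad ℝ L x) :=
    adj fun w z => by simp [hTx, hTy']
  -- As `J` is skew and `T` is the adjoint of `ad`, `e3` and `e4` make all the terms mixing `J` with
  -- `ad` or `T` cancel in the product `N_x N_y`.
  have e3 : trace ℝ L (Tx ∘ₗ Jy) = -trace ℝ L (LieAlgebra.ad ℝ L x ∘ₗ Jy) := by
    rw [LinearMap.trace_comp_comm' Jy (LieAlgebra.ad ℝ L x), ← map_neg]
    exact adj fun w z => by simp [hTx, skew hJy]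
  have e4 : trace ℝ L (Jx ∘ₗ Ty) = -trace ℝ L (Jx ∘ₗ LieAlgebra.ad ℝ L y) := by
    rw [LinearMap.trace_comp_comm' (LieAlgebra.ad ℝ L y) Jx, ← map_neg]
    exact adj fun w z => by
      simp only [LinearMap.comp_apply, LinearMap.neg_apply, map_neg, LieAlgebra.ad_apply, ← hTy,
        skew hJx, neg_neg]
  have e5 : trace ℝ L (LieAlgebra.ad ℝ L x ∘ₗ Ty) = trace ℝ L (Ty ∘ₗ LieAlgebra.ad ℝ L x) :=
    LinearMap.trace_comp_comm' _ _
  rw [ricciForm_eq, flip_eq hTx hJx, flip_eq hTy hJy]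
  simp only [LinearMap.smul_comp, LinearMap.comp_smul, LinearMap.sub_comp, LinearMap.comp_sub,
    map_smul, map_sub, smul_eq_mul, e1, e2, e3, e4, e5]
  ring

end Finite

/-! ### Extensions of a metric Lie algebra by a symmetric derivation -/

/-- The metric Lie algebra `(L, g)` is the orthogonal sum of the line `ℝ H` and of the image of
`(K, h)`, and `H` acts on `K` by a symmetric derivation `D`. -/
structure IsLineExtension {K : Type*} [LieRing K] [LieAlgebra ℝ K] (g : LieMetric L)
    (h : LieMetric K) (i : K →ₗ⁅ℝ⁆ L) (H : L) (D : K →ₗ[ℝ] K) : Prop where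
  form_map : ∀ u v, g.form (i u) (i v) = h.form u v
  form_line : ∀ u, g.form H (i u) = 0
  lie_line : ∀ u, ⁅H, i u⁆ = i (D u)
  symm : ∀ u v, h.form (D u) v = h.form u (D v)
  exists_eq : ∀ x, ∃ (t : ℝ) (u : K), x = t • H + i u

namespace IsLineExtension

variable {K : Type*} [LieRing K] [LieAlgebra ℝ K] {g : LieMetric L}
  {h : LieMetric K} {i : K →ₗ⁅ℝ⁆ L} {H : L} {D : K →ₗ[ℝ] K}

theorem eq_of_form (E : IsLineExtension g h i H D) {x y : L} (hH : g.form x H = g.form y H)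
    (hi : ∀ u, g.form x (i u) = g.form y (i u)) : x = y := by
  refine g.ext_form fun z => ?_
  obtain ⟨t, u, rfl⟩ := E.exists_eq z
  simp [hH, hi]

theorem form_map_line (E : IsLineExtension g h i H D) (u : K) : g.form (i u) H = 0 := by
  rw [g.symm, E.form_line]

theorem lie_map_line (E : IsLineExtension g h i H D) (u : K) : ⁅i u, H⁆ = -i (D u) := by
  rw [← lie_skew, E.lie_line]

theorem leviCivita_line_line [Module.Finite ℝ L] (E : IsLineExtension g h i H D) :
    g.leviCivita H H = 0 := by
  refine E.eq_of_form ?_ fun u => ?_ <;>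
    simp [form_leviCivita, E.lie_line, E.lie_map_line, E.form_map_line]

/-- In the Koszul formula the component along `K` is the skew part of `D`, which is zero. -/
theorem leviCivita_line_map [Module.Finite ℝ L] (E : IsLineExtension g h i H D) (u : K) :
    g.leviCivita H (i u) = 0 := by
  refine E.eq_of_form ?_ fun v => ?_
  · simp [form_leviCivita, E.lie_line, E.lie_map_line, E.form_map_line]
  · simp [form_leviCivita, E.lie_line, E.lie_map_line, E.form_map_line, E.form_map,
      ← LieHom.map_lie, E.symm, h.symm v]

theorem leviCivita_map_line [Module.Finite ℝ L] (E : IsLineExtension g h i H D) (u : K) :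
    g.leviCivita (i u) H = -i (D u) := by
  have h1 := g.leviCivita_sub H (i u)
  rw [E.leviCivita_line_map, E.lie_line, zero_sub] at h1
  rw [← h1, neg_neg]

section Finite

variable [Module.Finite ℝ K]

variable (g h i) in
/-- The orthogonal projection of `L` onto `K`. -/
noncomputable def proj : L →ₗ[ℝ] K :=
  h.sharp ∘ₗ g.form.compl₂ (i : K →ₗ[ℝ] L)

theorem proj_map (E : IsLineExtension g h i H D) (u : K) : proj g h i (i u) = u :=
  h.ext_form fun v => by simp [proj, form_sharp, E.form_map]

theorem proj_line (E : IsLineExtension g h i H D) : proj g h i H = 0 :=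
  h.ext_form fun v => by simp [proj, form_sharp, E.form_line]

/-- The line may be degenerate, with `H = 0`. Then `D = 0` too, so the quotients by `g.form H H`
below remain correct with division by zero equal to zero. -/
theorem eq_zero_of_form_line (E : IsLineExtension g h i H D) (hH : g.form H H = 0) (u : K) :
    D u = 0 := by
  have h0 : H = 0 := by
    by_contra hne
    exact (g.posDef H hne).ne' hH
  have h1 := E.lie_line u
  rw [h0, zero_lie] at h1
  rw [← E.proj_map (D u), ← h1, map_zero]

/-- `D` is symmetric and `∇_u` is skew, so `tr (D ∇_u) = 0`; what is left of `N_u = ∇_u - ad u` is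
`-ad u`. -/
theorem trace_comp_leviCivita (E : IsLineExtension g h i H D) (u : K) :
    trace ℝ K (D ∘ₗ h.leviCivita.flip u) = -trace ℝ K (D ∘ₗ LieAlgebra.ad ℝ K u) := by
  have h1 : trace ℝ K (D ∘ₗ h.leviCivita u) = 0 := by
    have h2 : trace ℝ K (D ∘ₗ h.leviCivita u) = trace ℝ K (-(h.leviCivita u ∘ₗ D)) :=
      LinearMap.trace_eq_of_adjoint h.nondegenerate fun x y => by
        simp [E.symm, form_leviCivita_skew]
    rw [map_neg, LinearMap.trace_comp_comm' D] at h2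
    linarith
  rw [leviCivita_flip, LinearMap.comp_sub, map_sub, h1, zero_sub]

theorem map_proj (E : IsLineExtension g h i H D) {x : L} (hx : g.form x H = 0) :
    i (proj g h i x) = x := by
  refine E.eq_of_form (by rw [E.form_map_line, hx]) fun u => ?_
  rw [E.form_map]
  simp [proj, form_sharp]

variable [Module.Finite ℝ L]

/-- The trace of an operator on `L` that kills `H`. -/
theorem trace_eq_of_line_eq_zero (E : IsLineExtension g h i H D) {f : L →ₗ[ℝ] L} (hf : f H = 0) :
    trace ℝ L f = trace ℝ K (proj g h i ∘ₗ f ∘ₗ (i : K →ₗ[ℝ] L)) := by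
  rw [LinearMap.trace_comp_comm', LinearMap.comp_assoc]
  congr 1
  ext x
  obtain ⟨t, u, rfl⟩ := E.exists_eq x
  simp [hf, E.proj_map, E.proj_line]

/-- The trace of an operator on `L` whose range is orthogonal to `H`. -/
theorem trace_eq_of_form_line (E : IsLineExtension g h i H D) {f : L →ₗ[ℝ] L}
    (hf : ∀ x, g.form (f x) H = 0) :
    trace ℝ L f = trace ℝ K (proj g h i ∘ₗ f ∘ₗ (i : K →ₗ[ℝ] L)) := by
  rw [← LinearMap.comp_assoc, LinearMap.trace_comp_comm']
  congr 1
  ext x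
  simp [E.map_proj (hf x)]

/-- The component along `H` is forced by `∇_u H = -D u` and metric compatibility; the component
along `K` is the Koszul formula of `K`. -/
theorem leviCivita_map_map (E : IsLineExtension g h i H D) (u v : K) :
    g.leviCivita (i u) (i v) =
      (h.form (D u) v / g.form H H) • H + i (h.leviCivita u v) := by
  refine E.eq_of_form ?_ fun w => ?_
  · rw [form_leviCivita_skew, E.leviCivita_map_line]
    by_cases hH : g.form H H = 0
    · simp [E.eq_zero_of_form_line hH, E.form_map_line]
    · simp [E.form_map, E.form_map_line, hH, E.symm, h.symm v]
  · simp [form_leviCivita, E.form_map, E.form_line, ← LieHom.map_lie]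

theorem trace_ad_map (E : IsLineExtension g h i H D) (u : K) :
    trace ℝ L (LieAlgebra.ad ℝ L (i u)) = trace ℝ K (LieAlgebra.ad ℝ K u) := by
  rw [E.trace_eq_of_form_line]
  · congr 1
    ext v
    simp [← LieHom.map_lie, E.proj_map]
  · intro x
    obtain ⟨t, v, rfl⟩ := E.exists_eq x
    simp [← LieHom.map_lie, E.lie_map_line, E.form_map_line]

theorem trace_ad_line (E : IsLineExtension g h i H D) :
    trace ℝ L (LieAlgebra.ad ℝ L H) = trace ℝ K D := by
  rw [E.trace_eq_of_line_eq_zero (by simp)]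
  congr 1
  ext v
  simp [E.lie_line, E.proj_map]

theorem ricciForm_line_line (E : IsLineExtension g h i H D) :
    g.ricciForm H H = -trace ℝ K (D ∘ₗ D) := by
  rw [ricciForm_eq, E.leviCivita_line_line, E.trace_eq_of_line_eq_zero]
  · simp only [map_zero, sub_zero]
    congr 2
    ext v
    simp [E.leviCivita_map_line, E.proj_map]
  · simp [E.leviCivita_line_line]

/-- Because `∇_H` vanishes on `K`, the operators `N_u` kill `H`, and `N_u N_v` has the same trace as
on `K`. The correction comes only from `tr ad (∇_u v)`, through the component of `∇_u v` along `H`.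
-/
theorem ricciForm_map_map (E : IsLineExtension g h i H D) (u v : K) :
    g.ricciForm (i u) (i v) =
      h.ricciForm u v - h.form (D u) v * (trace ℝ K D / g.form H H) := by
  rw [ricciForm_eq, ricciForm_eq, E.trace_eq_of_line_eq_zero, E.leviCivita_map_map, map_add,
    map_add, map_smul, map_smul, E.trace_ad_map, E.trace_ad_line]
  · have : proj g h i ∘ₗ (g.leviCivita.flip (i u) ∘ₗ g.leviCivita.flip (i v)) ∘ₗ
        (i : K →ₗ[ℝ] L) = h.leviCivita.flip u ∘ₗ h.leviCivita.flip v := by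
      ext w
      simp [E.leviCivita_map_map, E.leviCivita_line_map, E.proj_map, E.proj_line]
    rw [this, smul_eq_mul]
    ring
  · simp [E.leviCivita_line_map]

theorem ricciForm_line_map (E : IsLineExtension g h i H D) (u : K) :
    g.ricciForm H (i u) = -trace ℝ K (D ∘ₗ LieAlgebra.ad ℝ K u) := by
  rw [ricciForm_eq, E.leviCivita_line_map, E.trace_eq_of_line_eq_zero,
    ← E.trace_comp_leviCivita u, map_zero, map_zero, sub_zero, ← map_neg]
  · congr 1
    ext w
    simp [E.leviCivita_map_map, E.leviCivita_line_line, E.leviCivita_map_line, E.proj_map]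
  · simp [E.leviCivita_line_map]

/-- Computed separately from `ricciForm_line_map`, without appeal to symmetry of the Ricci form: the
quadratic trace is the same by cyclicity, but `∇_u H = -D u` adds a term. -/
theorem ricciForm_map_line (E : IsLineExtension g h i H D) (u : K) :
    g.ricciForm (i u) H =
      trace ℝ K (LieAlgebra.ad ℝ K (D u)) - trace ℝ K (D ∘ₗ LieAlgebra.ad ℝ K u) := by
  have h1 := E.ricciForm_line_map u
  rw [ricciForm_eq, E.leviCivita_line_map, map_zero, map_zero, sub_zero,
    LinearMap.trace_comp_comm'] at h1
  rw [ricciForm_eq, h1, E.leviCivita_map_line, map_neg, map_neg, E.trace_ad_map]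
  ring

end Finite

end IsLineExtension

end LieMetric

/-! ### Projections attached to a gradation -/

namespace LieGradation

open LinearMap (trace)

variable {𝔤 : Type*} [LieRing 𝔤] [LieAlgebra ℝ 𝔤] (G : LieGradation 𝔤)

theorem induction_deg {p : 𝔤 → Prop} (hdeg : ∀ (k : ℤ) (x : 𝔤), x ∈ G.deg k → p x)
    (hadd : ∀ x y, p x → p y → p (x + y)) (x : 𝔤) : p x :=
  Submodule.iSup_induction G.deg (motive := p)
    (by rw [G.isInternal.submodule_iSup_eq_top]; trivial) hdeg
    (hdeg 0 0 (zero_mem _)) hadd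

theorem induction_posPart {p : 𝔤 → Prop}
    (hdeg : ∀ (k : ℤ), 0 < k → ∀ x : 𝔤, x ∈ G.deg k → p x)
    (hadd : ∀ x y, p x → p y → p (x + y)) {x : 𝔤} (hx : x ∈ G.posPart) : p x :=
  Submodule.iSup_induction (fun k : {k : ℤ // 0 < k} => G.deg k) (motive := p) hx
    (fun k x hx => hdeg k k.2 x hx) (hdeg 1 one_pos 0 (zero_mem _)) hadd

theorem hom_ext {f f' : 𝔤 →ₗ[ℝ] 𝔤} (h : ∀ (k : ℤ) (x : 𝔤), x ∈ G.deg k → f x = f' x) :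
    f = f' := by
  ext x
  refine G.induction_deg (p := fun x => f x = f' x) h (fun x y hx hy => ?_) x
  rw [map_add, map_add, hx, hy]

theorem equiv_symm_of_mem {k : ℤ} {x : 𝔤} (hx : x ∈ G.deg k) :
    (LinearEquiv.ofBijective (DirectSum.coeLinearMap G.deg) G.isInternal).symm x =
      DirectSum.lof ℝ ℤ (fun k => G.deg k) k ⟨x, hx⟩ := by
  rw [LinearEquiv.symm_apply_eq]
  change x = DirectSum.coeLinearMap G.deg _
  rw [DirectSum.coeLinearMap_lof]

open Classical in
/-- The projection of `𝔤` onto the sum of the `𝔤_k` with `k ∈ S`, along the sum of the others. -/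
noncomputable def projOn (S : Set ℤ) : 𝔤 →ₗ[ℝ] 𝔤 :=
  DirectSum.toModule ℝ ℤ 𝔤 (fun k => if k ∈ S then (G.deg k).subtype else 0) ∘ₗ
    (LinearEquiv.ofBijective (DirectSum.coeLinearMap G.deg) G.isInternal).symm.toLinearMap

theorem projOn_of_mem {S : Set ℤ} {k : ℤ} (hk : k ∈ S) {x : 𝔤} (hx : x ∈ G.deg k) :
    G.projOn S x = x := by
  simp [projOn, G.equiv_symm_of_mem hx, DirectSum.toModule_lof, hk]

theorem projOn_of_notMem {S : Set ℤ} {k : ℤ} (hk : k ∉ S) {x : 𝔤} (hx : x ∈ G.deg k) :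
    G.projOn S x = 0 := by
  simp [projOn, G.equiv_symm_of_mem hx, DirectSum.toModule_lof, hk]

theorem projZero_of_mem {x : 𝔤} (hx : x ∈ G.deg 0) : G.projZero x = x := by
  simp [projZero, G.equiv_symm_of_mem hx, DirectSum.component.lof_self]

theorem projZero_of_ne {k : ℤ} (hk : k ≠ 0) {x : 𝔤} (hx : x ∈ G.deg k) : G.projZero x = 0 := by
  simp [projZero, G.equiv_symm_of_mem hx, DirectSum.component.of, hk]

theorem projZero_of_mem_posPart {x : 𝔤} (hx : x ∈ G.posPart) : G.projZero x = 0 :=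
  G.induction_posPart (p := fun x => G.projZero x = 0) (fun _ hk _ hx => G.projZero_of_ne hk.ne' hx)
    (fun x y hx hy => by rw [map_add, hx, hy, add_zero]) hx

/-- The projection onto the part of positive degree. -/
noncomputable abbrev projPos : 𝔤 →ₗ[ℝ] 𝔤 := G.projOn (Set.Ioi 0)

/-- The projection onto the part of negative degree. -/
noncomputable abbrev projNeg : 𝔤 →ₗ[ℝ] 𝔤 := G.projOn (Set.Iio 0)

theorem projPos_add_projNeg_add : G.projPos + G.projNeg + G.projOn {0} = LinearMap.id := by
  refine G.hom_ext fun k x hx => ?_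
  rcases lt_trichotomy k 0 with h | h | h
  · rw [LinearMap.add_apply, LinearMap.add_apply, G.projOn_of_notMem (by simpa using h.le) hx,
      G.projOn_of_mem (by simpa using h) hx, G.projOn_of_notMem (by simpa using h.ne) hx]
    simp
  · rw [LinearMap.add_apply, LinearMap.add_apply, G.projOn_of_notMem (by simp [h]) hx,
      G.projOn_of_notMem (by simp [h]) hx, G.projOn_of_mem (by simp [h]) hx]
    simp
  · rw [LinearMap.add_apply, LinearMap.add_apply, G.projOn_of_mem (by simpa using h) hx,
      G.projOn_of_notMem (by simpa using h.le) hx, G.projOn_of_notMem (by simpa using h.ne') hx]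
    simp

theorem projPos_mem (x : 𝔤) : G.projPos x ∈ G.posPart := by
  refine G.induction_deg (p := fun x => G.projPos x ∈ G.posPart) (fun k x hx => ?_)
    (fun x y hx hy => by rw [map_add]; exact add_mem hx hy) x
  by_cases hk : k ∈ Set.Ioi (0 : ℤ)
  · rw [G.projOn_of_mem hk hx]
    exact G.deg_le_posPart hk hx
  · rw [G.projOn_of_notMem hk hx]
    exact zero_mem _

theorem projPos_eq_self {x : 𝔤} (hx : x ∈ G.posPart) : G.projPos x = x :=
  G.induction_posPart (p := fun x => G.projPos x = x) (fun _ hk _ hx => G.projOn_of_mem hk hx)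
    (fun x y hx hy => by rw [map_add, hx, hy]) hx

theorem projOn_lie_of_mem_zero (S : Set ℤ) {x : 𝔤} (hx : x ∈ G.deg 0) (y : 𝔤) :
    G.projOn S ⁅x, y⁆ = ⁅x, G.projOn S y⁆ := by
  refine G.induction_deg (p := fun y => G.projOn S ⁅x, y⁆ = ⁅x, G.projOn S y⁆) (fun k y hy => ?_)
    (fun y z hy hz => by rw [lie_add, map_add, hy, hz, map_add, lie_add]) y
  have h := G.lie_mem 0 k x y hx hy
  rw [zero_add] at h
  by_cases hk : k ∈ S
  · rw [G.projOn_of_mem hk hy, G.projOn_of_mem hk h]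
  · rw [G.projOn_of_notMem hk hy, G.projOn_of_notMem hk h, lie_zero]

/-- Elements of positive degree send the part of nonnegative degree to positive degrees. -/
theorem projOn_lie_projNeg {S : Set ℤ} (hS : ∀ k ∈ S, k ≤ 0) {u : 𝔤} (hu : u ∈ G.posPart)
    (x : 𝔤) : G.projOn S ⁅u, G.projNeg x⁆ = G.projOn S ⁅u, x⁆ := by
  refine G.induction_deg (p := fun x => G.projOn S ⁅u, G.projNeg x⁆ = G.projOn S ⁅u, x⁆)
    (fun l x hx => ?_) (fun y z hy hz => by simp only [lie_add, map_add, hy, hz]) x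
  by_cases hl : l ∈ Set.Iio (0 : ℤ)
  · rw [G.projOn_of_mem hl hx]
  · rw [G.projOn_of_notMem hl hx, lie_zero, map_zero, eq_comm]
    refine G.induction_posPart (p := fun u => G.projOn S ⁅u, x⁆ = 0) (fun k hk u hu => ?_)
      (fun y z hy hz => by rw [add_lie, map_add, hy, hz, add_zero]) hu
    refine G.projOn_of_notMem (fun h => ?_) (G.lie_mem k l u x hu hx)
    have := hS _ h
    rw [Set.mem_Iio] at hl
    omega

variable {G} in
theorem IsGradeReversing.apply_mem {σ : 𝔤 ≃ₗ⁅ℝ⁆ 𝔤} (hσG : G.IsGradeReversing σ) {k : ℤ} {x : 𝔤}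
    (hx : x ∈ G.deg k) : σ x ∈ G.deg (-k) := by
  rw [← hσG k]
  exact Submodule.mem_map_of_mem hx

variable {G} in
theorem IsGradeReversing.apply_projPos {σ : 𝔤 ≃ₗ⁅ℝ⁆ 𝔤} (hσG : G.IsGradeReversing σ) (x : 𝔤) :
    σ (G.projPos x) = G.projNeg (σ x) := by
  refine G.induction_deg (p := fun x => σ (G.projPos x) = G.projNeg (σ x)) (fun k x hx => ?_)
    (fun y z hy hz => by simp only [map_add, hy, hz]) x
  by_cases hk : k ∈ Set.Ioi (0 : ℤ)
  · rw [G.projOn_of_mem hk hx, G.projOn_of_mem (by simpa using hk) (hσG.apply_mem hx)]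
  · rw [G.projOn_of_notMem hk hx, G.projOn_of_notMem (by simpa using hk) (hσG.apply_mem hx),
      map_zero]

/-! ### Degree and traces -/

variable {G} in
theorem IsCharacteristic.mem_zero {Z : 𝔤} (hZ : G.IsCharacteristic Z) : Z ∈ G.deg 0 :=
  (hZ 0 Z).2 (by simp)

theorem killingForm_lie_left (x y z : 𝔤) :
    killingForm ℝ 𝔤 ⁅x, y⁆ z = -killingForm ℝ 𝔤 y ⁅x, z⁆ := by
  rw [← lie_skew, map_neg, LinearMap.neg_apply, LieModule.traceForm_apply_lie_apply]

section Trace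

variable {G} [Module.Finite ℝ 𝔤] {Z : 𝔤}

/-- `ad Z` commutes with the graded projections, so the operator has weight `k + l` under
commutation with `ad Z`. -/
theorem IsCharacteristic.trace_ad_ad_projOn (hZ : G.IsCharacteristic Z) (S : Set ℤ) {k l : ℤ}
    (hkl : k + l ≠ 0) {x y : 𝔤} (hx : x ∈ G.deg k) (hy : y ∈ G.deg l) :
    trace ℝ 𝔤 (LieAlgebra.ad ℝ 𝔤 x ∘ₗ LieAlgebra.ad ℝ 𝔤 y ∘ₗ G.projOn S) = 0 := by
  refine LinearMap.trace_eq_zero_of_commutator (d := LieAlgebra.ad ℝ 𝔤 Z) (c := k + l)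
    (by exact_mod_cast hkl) ?_
  ext w
  simp only [LinearMap.sub_apply, LinearMap.comp_apply, LieAlgebra.ad_apply,
    G.projOn_lie_of_mem_zero S hZ.mem_zero, LinearMap.smul_apply]
  rw [leibniz_lie Z x, leibniz_lie Z y, (hZ k x).1 hx, (hZ l y).1 hy]
  simp only [lie_add, smul_lie, lie_smul, add_smul]
  abel

theorem IsCharacteristic.trace_ad_projOn (hZ : G.IsCharacteristic Z) (S : Set ℤ) {k : ℤ}
    (hk : k ≠ 0) {x : 𝔤} (hx : x ∈ G.deg k) :
    trace ℝ 𝔤 (LieAlgebra.ad ℝ 𝔤 x ∘ₗ G.projOn S) = 0 := by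
  refine LinearMap.trace_eq_zero_of_commutator (d := LieAlgebra.ad ℝ 𝔤 Z) (c := k)
    (by exact_mod_cast hk) ?_
  ext w
  simp only [LinearMap.sub_apply, LinearMap.comp_apply, LieAlgebra.ad_apply,
    G.projOn_lie_of_mem_zero S hZ.mem_zero, LinearMap.smul_apply]
  rw [leibniz_lie Z x, (hZ k x).1 hx]
  simp

theorem IsCharacteristic.trace_ad_ad_projOn_posPart (hZ : G.IsCharacteristic Z) (S : Set ℤ)
    {k : ℤ} (hk : 0 ≤ k) {x y : 𝔤} (hx : x ∈ G.deg k) (hy : y ∈ G.posPart) :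
    trace ℝ 𝔤 (LieAlgebra.ad ℝ 𝔤 x ∘ₗ LieAlgebra.ad ℝ 𝔤 y ∘ₗ G.projOn S) = 0 := by
  refine G.induction_posPart (p := fun y =>
    trace ℝ 𝔤 (LieAlgebra.ad ℝ 𝔤 x ∘ₗ LieAlgebra.ad ℝ 𝔤 y ∘ₗ G.projOn S) = 0)
    (fun l hl y hy => hZ.trace_ad_ad_projOn S (by omega) hx hy) (fun y z hy hz => ?_) hy
  rw [map_add, LinearMap.add_comp, LinearMap.comp_add, map_add, hy, hz, add_zero]

theorem IsCharacteristic.trace_ad_projOn_posPart (hZ : G.IsCharacteristic Z) (S : Set ℤ)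
    {x : 𝔤} (hx : x ∈ G.posPart) : trace ℝ 𝔤 (LieAlgebra.ad ℝ 𝔤 x ∘ₗ G.projOn S) = 0 := by
  refine G.induction_posPart (p := fun x => trace ℝ 𝔤 (LieAlgebra.ad ℝ 𝔤 x ∘ₗ G.projOn S) = 0)
    (fun l hl x hx => hZ.trace_ad_projOn S hl.ne' hx) (fun y z hy hz => ?_) hx
  rw [map_add, LinearMap.add_comp, map_add, hy, hz, add_zero]

theorem IsCharacteristic.killingForm_eq_zero (hZ : G.IsCharacteristic Z) {k l : ℤ}
    (hkl : k + l ≠ 0) {x y : 𝔤} (hx : x ∈ G.deg k) (hy : y ∈ G.deg l) :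
    killingForm ℝ 𝔤 x y = 0 := by
  have h : G.projOn Set.univ = LinearMap.id :=
    G.hom_ext fun k x hx => G.projOn_of_mem (Set.mem_univ k) hx
  have h1 := hZ.trace_ad_ad_projOn Set.univ hkl hx hy
  rwa [h, LinearMap.comp_id] at h1

/-- The Killing form pairs `𝔤_k` only with `𝔤_{-k}`, so the adjoint of the projection onto degrees
in `S` is the projection onto degrees in `-S`. -/
theorem IsCharacteristic.killingForm_projOn (hZ : G.IsCharacteristic Z) {S T : Set ℤ}
    (hST : ∀ k, k ∈ S ↔ -k ∈ T) (x y : 𝔤) :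
    killingForm ℝ 𝔤 (G.projOn S x) y = killingForm ℝ 𝔤 x (G.projOn T y) := by
  refine G.induction_deg
    (p := fun x => killingForm ℝ 𝔤 (G.projOn S x) y = killingForm ℝ 𝔤 x (G.projOn T y))
    (fun k x hx => ?_) (fun y z hy hz => by simp only [map_add, LinearMap.add_apply, hy, hz]) x
  refine G.induction_deg
    (p := fun y => killingForm ℝ 𝔤 (G.projOn S x) y = killingForm ℝ 𝔤 x (G.projOn T y))
    (fun l y hy => ?_) (fun y z hy hz => by simp only [map_add, hy, hz]) y
  have hS : G.projOn S x = x ∨ G.projOn S x = 0 := by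
    by_cases hk : k ∈ S
    · exact Or.inl (G.projOn_of_mem hk hx)
    · exact Or.inr (G.projOn_of_notMem hk hx)
  have hT : G.projOn T y = y ∨ G.projOn T y = 0 := by
    by_cases hl : l ∈ T
    · exact Or.inl (G.projOn_of_mem hl hy)
    · exact Or.inr (G.projOn_of_notMem hl hy)
  by_cases hkl : k + l = 0
  · obtain rfl : l = -k := by omega
    by_cases hk : k ∈ S
    · rw [G.projOn_of_mem hk hx, G.projOn_of_mem ((hST k).1 hk) hy]
    · rw [G.projOn_of_notMem hk hx, G.projOn_of_notMem (fun h => hk ((hST k).2 h)) hy]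
      simp
  · have h := hZ.killingForm_eq_zero hkl hx hy
    rcases hS with hS | hS <;> rcases hT with hT | hT <;> simp [hS, hT, h]

theorem IsCharacteristic.killingForm_projPos (hZ : G.IsCharacteristic Z) (x y : 𝔤) :
    killingForm ℝ 𝔤 (G.projPos x) y = killingForm ℝ 𝔤 x (G.projNeg y) :=
  hZ.killingForm_projOn (by simp) x y

theorem IsCharacteristic.killingForm_projNeg (hZ : G.IsCharacteristic Z) (x y : 𝔤) :
    killingForm ℝ 𝔤 (G.projNeg x) y = killingForm ℝ 𝔤 x (G.projPos y) :=
  hZ.killingForm_projOn (by simp) x y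

theorem trace_eq_of_killing_adjoint (hκ : (killingForm ℝ 𝔤).Nondegenerate) {f f' : 𝔤 →ₗ[ℝ] 𝔤}
    (h : ∀ x y, killingForm ℝ 𝔤 (f x) y = killingForm ℝ 𝔤 x (f' y)) :
    trace ℝ 𝔤 f = trace ℝ 𝔤 f' :=
  LinearMap.trace_eq_of_adjoint hκ h

/-- A splitting of the Killing form `B(u, v) = tr (ad u ad v)` for `u` of positive degree. -/
theorem IsCharacteristic.killingForm_eq_trace (hZ : G.IsCharacteristic Z)
    (hκ : (killingForm ℝ 𝔤).Nondegenerate) {u : 𝔤} (hu : u ∈ G.posPart) (v : 𝔤) :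
    killingForm ℝ 𝔤 u v =
      2 * trace ℝ 𝔤 (LieAlgebra.ad ℝ 𝔤 u ∘ₗ LieAlgebra.ad ℝ 𝔤 v ∘ₗ G.projPos)
      - trace ℝ 𝔤 (LieAlgebra.ad ℝ 𝔤 u ∘ₗ G.projNeg ∘ₗ LieAlgebra.ad ℝ 𝔤 v ∘ₗ G.projPos) := by
  set A := LieAlgebra.ad ℝ 𝔤 u with hA
  set A' := LieAlgebra.ad ℝ 𝔤 v with hA'
  set P := G.projPos with hP
  set M := G.projNeg with hM
  set Q := G.projOn {0} with hQ
  have hid : P + M + Q = LinearMap.id := G.projPos_add_projNeg_add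
  have hκA : ∀ x y, killingForm ℝ 𝔤 (A x) y = -killingForm ℝ 𝔤 x (A y) :=
    fun x y => killingForm_lie_left u x y
  have hκA' : ∀ x y, killingForm ℝ 𝔤 (A' x) y = -killingForm ℝ 𝔤 x (A' y) :=
    fun x y => killingForm_lie_left v x y
  have hκM : ∀ x y, killingForm ℝ 𝔤 (M x) y = killingForm ℝ 𝔤 x (P y) := hZ.killingForm_projNeg
  have hκQ : ∀ x y, killingForm ℝ 𝔤 (Q x) y = killingForm ℝ 𝔤 x (Q y) :=
    hZ.killingForm_projOn (by simp)
  -- As `u` has positive degree, components of `[u, x]` in degree at most `0` come from the negative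
  -- part of `x` only.
  have hQA : Q ∘ₗ A = Q ∘ₗ A ∘ₗ M := by
    ext x
    exact (G.projOn_lie_projNeg (by simp) hu x).symm
  have hMA : M ∘ₗ A = M ∘ₗ A ∘ₗ M := by
    ext x
    exact (G.projOn_lie_projNeg (fun k hk => le_of_lt hk) hu x).symm
  -- Pass to the Killing adjoint: `M` becomes `P`, `Q` is fixed, and the signs of `A` and `A'`
  -- cancel.
  have e1 : trace ℝ 𝔤 (Q ∘ₗ A ∘ₗ A') = trace ℝ 𝔤 (A ∘ₗ Q ∘ₗ A' ∘ₗ P) := by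
    rw [← LinearMap.comp_assoc, hQA]
    have : trace ℝ 𝔤 ((Q ∘ₗ A ∘ₗ M) ∘ₗ A') = trace ℝ 𝔤 ((A' ∘ₗ P) ∘ₗ (A ∘ₗ Q)) :=
      trace_eq_of_killing_adjoint hκ fun x y => by simp [hκA, hκA', hκM, hκQ]
    rw [this, LinearMap.trace_comp_comm']
    rfl
  have e2 : trace ℝ 𝔤 (M ∘ₗ A ∘ₗ A') = trace ℝ 𝔤 (A ∘ₗ P ∘ₗ A' ∘ₗ P) := by
    rw [← LinearMap.comp_assoc, hMA]
    have : trace ℝ 𝔤 ((M ∘ₗ A ∘ₗ M) ∘ₗ A') = trace ℝ 𝔤 ((A' ∘ₗ P) ∘ₗ (A ∘ₗ P)) :=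
      trace_eq_of_killing_adjoint hκ fun x y => by simp [hκA, hκA', hκM]
    rw [this, LinearMap.trace_comp_comm']
    rfl
  have e3 : trace ℝ 𝔤 (P ∘ₗ A ∘ₗ A') = trace ℝ 𝔤 (A ∘ₗ A' ∘ₗ P) := by
    rw [LinearMap.trace_comp_comm']
    rfl
  have e4 : killingForm ℝ 𝔤 u v = trace ℝ 𝔤 ((P + M + Q) ∘ₗ A ∘ₗ A') := by
    rw [hid]
    rfl
  -- Inserting `P + M + Q` here trades the `P` and `Q` terms of `e1`, `e2` for `tr (A A' P)` minus
  -- the `M` term.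
  have e5 : trace ℝ 𝔤 (A ∘ₗ A' ∘ₗ P) = trace ℝ 𝔤 (A ∘ₗ (P + M + Q) ∘ₗ A' ∘ₗ P) := by
    rw [hid]
    rfl
  rw [LinearMap.add_comp, LinearMap.add_comp, map_add, map_add, e1, e2, e3] at e4
  rw [LinearMap.add_comp, LinearMap.add_comp, LinearMap.comp_add, LinearMap.comp_add, map_add,
    map_add] at e5
  linarith

end Trace

end LieGradation

/-! ### Killing form and metric of a Cartan involution -/

namespace IsCartanInvolution

variable {𝔤 : Type*} [LieRing 𝔤] [LieAlgebra ℝ 𝔤] {σ : 𝔤 ≃ₗ⁅ℝ⁆ 𝔤}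

theorem killingForm_nondegenerate (hσ : IsCartanInvolution σ) :
    (killingForm ℝ 𝔤).Nondegenerate := by
  refine ⟨fun x hx => ?_, fun x hx => ?_⟩
  · by_contra h
    exact (hσ.pos x h).ne' (by rw [hx, neg_zero])
  · by_contra h
    exact (hσ.pos x h).ne' (by rw [LieModule.traceForm_comm, hx, neg_zero])

theorem metric_form (hσ : IsCartanInvolution σ) (x y : 𝔤) :
    hσ.metric.form x y = -killingForm ℝ 𝔤 x (σ y) := rfl

theorem killingForm_apply_left (hσ : IsCartanInvolution σ) (x y : 𝔤) :
    killingForm ℝ 𝔤 (σ x) y = killingForm ℝ 𝔤 x (σ y) := by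
  have h := LieAlgebra.killingForm_of_equiv_apply σ x (σ y)
  rwa [hσ.involutive] at h

theorem metric_lie_left (hσ : IsCartanInvolution σ) (x y z : 𝔤) :
    hσ.metric.form ⁅x, y⁆ z = -hσ.metric.form y ⁅σ x, z⁆ := by
  rw [metric_form, metric_form, LieGradation.killingForm_lie_left, LieEquiv.map_lie,
    hσ.involutive]

end IsCartanInvolution

namespace LieGradation

open LinearMap (trace)

variable {𝔤 : Type*} [LieRing 𝔤] [LieAlgebra ℝ 𝔤] {G : LieGradation 𝔤}
  {Z : 𝔤} {σ : 𝔤 ≃ₗ⁅ℝ⁆ 𝔤}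

theorem lie_mem_posPart_of_mem_extension (G : LieGradation 𝔤) {𝔟 : Submodule ℝ 𝔤}
    (h0 : 𝔟 ≤ G.deg 0) (hab : IsAbelianSubspace 𝔟) {x y : 𝔤} (hx : x ∈ G.extension 𝔟 h0 hab)
    (hy : y ∈ G.extension 𝔟 h0 hab) : ⁅x, y⁆ ∈ G.posPart := by
  obtain ⟨b, hb, u, hu, rfl⟩ := Submodule.mem_sup.1 hx
  obtain ⟨c, hc, v, hv, rfl⟩ := Submodule.mem_sup.1 hy
  rw [add_lie, lie_add, lie_add, hab b hb c hc, zero_add, ← lie_skew u c]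
  exact add_mem (G.lie_mem_posPart_of_deg le_rfl (h0 hb) hv)
    (add_mem (neg_mem (G.lie_mem_posPart_of_deg le_rfl (h0 hc) hu)) (G.lie_mem_posPart hu hv))

theorem nilMetric_form (hσ : IsCartanInvolution σ) (u v : G.nilpart) :
    (G.nilMetric hσ).form u v = hσ.metric.form u v := rfl

variable (G) in
/-- The compression to `𝔫` of an operator on `𝔤`. -/
noncomputable def compress (F : 𝔤 →ₗ[ℝ] 𝔤) : G.nilpart →ₗ[ℝ] G.nilpart :=
  LinearMap.codRestrict G.nilpart.toSubmodule
    (G.projPos ∘ₗ F ∘ₗ G.nilpart.toSubmodule.subtype) fun _ => G.projPos_mem _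

theorem coe_compress (F : 𝔤 →ₗ[ℝ] 𝔤) (u : G.nilpart) :
    (G.compress F u : 𝔤) = G.projPos (F u) := rfl

/-! ### The solvable extension -/

variable {H : 𝔤}

theorem coe_compress_ad (hH0 : H ∈ G.deg 0) (u : G.nilpart) :
    (G.compress (LieAlgebra.ad ℝ 𝔤 H) u : 𝔤) = ⁅H, (u : 𝔤)⁆ := by
  rw [coe_compress, LieAlgebra.ad_apply,
    G.projPos_eq_self (G.lie_mem_posPart_of_deg le_rfl hH0 u.2)]

theorem nilpart_le_lineExtension (hH0 : H ∈ G.deg 0) : G.nilpart ≤ G.lineExtension H hH0 :=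
  fun _ hx => G.posPart_le_extension _ _ hx

theorem scaledMetric_form (hσ : IsCartanInvolution σ) (c : ℝ) (hc : 0 < c) (x y : 𝔤) :
    (G.scaledMetric hσ c hc).form x y = c * hσ.metric.form (G.projZero x) (G.projZero y) +
      hσ.metric.form (x - G.projZero x) (y - G.projZero y) := rfl

theorem lineMetric_form (hσ : IsCartanInvolution σ) (hH0 : H ∈ G.deg 0) (c : ℝ) (hc : 0 < c)
    (x y : G.lineExtension H hH0) :
    (G.lineMetric hσ H hH0 c hc).form x y = (G.scaledMetric hσ c hc).form x y := rfl

theorem mem_lineExtension_self (hH0 : H ∈ G.deg 0) : H ∈ G.lineExtension H hH0 :=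
  G.subspace_le_extension _ _ (Submodule.mem_span_singleton_self H)

/-- The condition `σ H = -H` is what makes `ad H` symmetric for `B_σ`. -/
theorem isLineExtension_lineMetric (hσ : IsCartanInvolution σ) (hH0 : H ∈ G.deg 0)
    (hHσ : σ H = -H) (c : ℝ) (hc : 0 < c) :
    (G.lineMetric hσ H hH0 c hc).IsLineExtension (G.nilMetric hσ)
      (LieSubalgebra.inclusion (nilpart_le_lineExtension hH0)) ⟨H, mem_lineExtension_self hH0⟩
      (G.compress (LieAlgebra.ad ℝ 𝔤 H)) where
  form_map u v := by
    rw [lineMetric_form, scaledMetric_form, nilMetric_form]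
    simp [G.projZero_of_mem_posPart u.2, G.projZero_of_mem_posPart v.2]
  form_line u := by
    rw [lineMetric_form, scaledMetric_form]
    simp [G.projZero_of_mem_posPart u.2, G.projZero_of_mem hH0]
  lie_line u := Subtype.ext (coe_compress_ad hH0 u).symm
  symm u v := by
    rw [nilMetric_form, nilMetric_form, coe_compress_ad hH0, coe_compress_ad hH0,
      hσ.metric_lie_left, hHσ, neg_lie, map_neg, neg_neg]
  exists_eq x := by
    obtain ⟨b, hb, u, hu, hx⟩ := Submodule.mem_sup.1 x.2
    obtain ⟨t, rfl⟩ := Submodule.mem_span_singleton.1 hb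
    exact ⟨t, ⟨u, hu⟩, Subtype.ext hx.symm⟩

theorem lineMetric_form_self (hσ : IsCartanInvolution σ) (hH0 : H ∈ G.deg 0) (hHσ : σ H = -H)
    (c : ℝ) (hc : 0 < c) :
    (G.lineMetric hσ H hH0 c hc).form ⟨H, mem_lineExtension_self hH0⟩
      ⟨H, mem_lineExtension_self hH0⟩ = c * killingForm ℝ 𝔤 H H := by
  rw [lineMetric_form, scaledMetric_form]
  simp [G.projZero_of_mem hH0, hσ.metric_form, hHσ]

section Finite

variable [Module.Finite ℝ 𝔤]

theorem IsCharacteristic.metric_projPos (hZ : G.IsCharacteristic Z) (hσ : IsCartanInvolution σ)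
    (hσG : G.IsGradeReversing σ) (x y : 𝔤) :
    hσ.metric.form (G.projPos x) y = hσ.metric.form x (G.projPos y) := by
  rw [hσ.metric_form, hσ.metric_form, hZ.killingForm_projPos, hσG.apply_projPos]

theorem IsCharacteristic.metric_eq_zero (hZ : G.IsCharacteristic Z) (hσ : IsCartanInvolution σ)
    (hσG : G.IsGradeReversing σ) {x y : 𝔤} (hx : x ∈ G.deg 0) (hy : y ∈ G.posPart) :
    hσ.metric.form x y = 0 := by
  rw [← G.projPos_eq_self hy, ← hZ.metric_projPos hσ hσG, G.projOn_of_notMem (by simp) hx]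
  simp

/-! ### The vector dual to the trace form of the action on the positive part -/

/-- `H` is dual, with respect to the Killing form, to `Y ↦ tr (π ∘ ad Y)` on the positive part,
where `π` is the projection onto it. -/
def IsTraceDual (G : LieGradation 𝔤) (H : 𝔤) : Prop :=
  ∀ Y, killingForm ℝ 𝔤 H Y = trace ℝ 𝔤 (LieAlgebra.ad ℝ 𝔤 Y ∘ₗ G.projPos)

theorem exists_isTraceDual (G : LieGradation 𝔤) (hκ : (killingForm ℝ 𝔤).Nondegenerate) :
    ∃ H, G.IsTraceDual H := by
  refine ⟨(LinearMap.BilinForm.toDual _ hκ).symm (trace ℝ 𝔤 ∘ₗ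
    (LinearMap.lcomp ℝ 𝔤 G.projPos) ∘ₗ (LieAlgebra.ad ℝ 𝔤 : 𝔤 →ₗ[ℝ] Module.End ℝ 𝔤)),
    fun Y => ?_⟩
  rw [LinearMap.BilinForm.apply_toDual_symm_apply (hB := hκ)]
  rfl

/-- `ad x` preserves degrees and so commutes with `P`; hence `ad [x, Y] ∘ P` is a commutator and is
traceless. Nondegeneracy concludes. -/
theorem IsTraceDual.lie_eq_zero {H : 𝔤} (hH : G.IsTraceDual H)
    (hκ : (killingForm ℝ 𝔤).Nondegenerate) {x : 𝔤} (hx : x ∈ G.deg 0) : ⁅x, H⁆ = 0 := by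
  refine hκ.1 _ fun Y => ?_
  have hc : G.projPos ∘ₗ LieAlgebra.ad ℝ 𝔤 x = LieAlgebra.ad ℝ 𝔤 x ∘ₗ G.projPos := by
    ext y
    exact G.projOn_lie_of_mem_zero _ hx y
  have h1 : LieAlgebra.ad ℝ 𝔤 ⁅x, Y⁆ ∘ₗ G.projPos =
      LieAlgebra.ad ℝ 𝔤 x ∘ₗ (LieAlgebra.ad ℝ 𝔤 Y ∘ₗ G.projPos) -
        (LieAlgebra.ad ℝ 𝔤 Y ∘ₗ G.projPos) ∘ₗ LieAlgebra.ad ℝ 𝔤 x := by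
    rw [LinearMap.comp_assoc, hc]
    ext y
    simp
  rw [killingForm_lie_left, hH, h1, map_sub, LinearMap.trace_comp_comm', sub_self, neg_zero]

/-- Conjugation by `σ` exchanges `P` and `M`, while the Killing adjoint of `ad Y ∘ M` is `-P ∘ ad
Y`. Together they give `B(σ H, Y) = -B(H, Y)`. -/
theorem IsTraceDual.apply_eq_neg {H : 𝔤} (hH : G.IsTraceDual H) (hZ : G.IsCharacteristic Z)
    (hσ : IsCartanInvolution σ) (hσG : G.IsGradeReversing σ) : σ H = -H := by
  have hκ := hσ.killingForm_nondegenerate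
  rw [← add_eq_zero_iff_eq_neg]
  refine hκ.1 _ fun Y => ?_
  have h1 : trace ℝ 𝔤 (LieAlgebra.ad ℝ 𝔤 (σ Y) ∘ₗ G.projPos) =
      trace ℝ 𝔤 (LieAlgebra.ad ℝ 𝔤 Y ∘ₗ G.projNeg) := by
    have h2 : LieAlgebra.ad ℝ 𝔤 Y ∘ₗ G.projNeg =
        (σ.toLinearEquiv : 𝔤 ≃ₗ[ℝ] 𝔤).conj (LieAlgebra.ad ℝ 𝔤 (σ Y) ∘ₗ G.projPos) := by
      ext y
      obtain ⟨z, rfl⟩ := σ.surjective y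
      change ⁅Y, G.projNeg (σ z)⁆ = σ ⁅σ Y, G.projPos (σ.toLinearEquiv.symm (σ.toLinearEquiv z))⁆
      rw [LinearEquiv.symm_apply_apply, LieEquiv.map_lie, hσ.involutive, hσG.apply_projPos]
    rw [h2, LinearMap.trace_conj']
  have h2 : trace ℝ 𝔤 (LieAlgebra.ad ℝ 𝔤 Y ∘ₗ G.projNeg) =
      trace ℝ 𝔤 (-(G.projPos ∘ₗ LieAlgebra.ad ℝ 𝔤 Y)) :=
    trace_eq_of_killing_adjoint hκ fun x y => by
      simp [killingForm_lie_left, hZ.killingForm_projNeg]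
  rw [map_add, LinearMap.add_apply, hσ.killingForm_apply_left, hH, hH, h1, h2, map_neg,
    LinearMap.trace_comp_comm', neg_add_cancel]

/-- The trace of the square of `ad H` on the positive part. -/
theorem IsTraceDual.killingForm_self {H : 𝔤} (hH : G.IsTraceDual H) (hZ : G.IsCharacteristic Z)
    (hκ : (killingForm ℝ 𝔤).Nondegenerate) :
    killingForm ℝ 𝔤 H H =
      2 * trace ℝ 𝔤 (LieAlgebra.ad ℝ 𝔤 H ∘ₗ LieAlgebra.ad ℝ 𝔤 H ∘ₗ G.projPos) := by
  set A := LieAlgebra.ad ℝ 𝔤 H with hA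
  -- `H` centralizes `𝔤_0`, so degree zero contributes nothing; the positive and negative parts
  -- contribute equally by `h1`, whence the factor 2.
  have h0 : A ∘ₗ A ∘ₗ G.projOn {0} = 0 := by
    refine G.hom_ext fun k x hx => ?_
    by_cases hk : k = 0
    · subst hk
      have : ⁅H, x⁆ = 0 := by rw [← lie_skew, hH.lie_eq_zero hκ hx, neg_zero]
      simp [G.projOn_of_mem (Set.mem_singleton _) hx, hA, this]
    · simp [G.projOn_of_notMem (S := {0}) (by simpa using hk) hx]
  have h1 : trace ℝ 𝔤 (A ∘ₗ A ∘ₗ G.projNeg) = trace ℝ 𝔤 (A ∘ₗ A ∘ₗ G.projPos) := by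
    rw [← LinearMap.comp_assoc G.projPos A A, LinearMap.trace_comp_comm' G.projPos]
    refine trace_eq_of_killing_adjoint hκ fun x y => ?_
    simp [hA, killingForm_lie_left, hZ.killingForm_projNeg]
  have h2 : killingForm ℝ 𝔤 H H =
      trace ℝ 𝔤 (A ∘ₗ A ∘ₗ (G.projPos + G.projNeg + G.projOn {0})) := by
    rw [G.projPos_add_projNeg_add]
    rfl
  rw [h2]
  simp only [LinearMap.comp_add, map_add, h1, h0, map_zero]
  ring

/-! ### Traces on subalgebras containing the positive part -/

/-- The trace of an operator on a subalgebra which maps into the positive part. -/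
theorem trace_eq_trace_projPos {E : LieSubalgebra ℝ 𝔤} (hE : G.posPart ≤ E.toSubmodule)
    {f : E →ₗ[ℝ] E} {F : 𝔤 →ₗ[ℝ] 𝔤} (h : ∀ x : E, (f x : 𝔤) = G.projPos (F x)) :
    trace ℝ E f = trace ℝ 𝔤 (F ∘ₗ G.projPos) := by
  let p : 𝔤 →ₗ[ℝ] E := LinearMap.codRestrict E.toSubmodule G.projPos
    fun x => hE (G.projPos_mem x)
  have h1 : f = p ∘ₗ (F ∘ₗ E.toSubmodule.subtype) := by
    ext x
    exact h x
  rw [h1, LinearMap.trace_comp_comm']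
  rfl

/-- The mean curvature vector of `𝔞 + 𝔫` is dual to the trace form of the positive part. -/
theorem isTraceDual_of_isMeanCurvatureVector (hZ : G.IsCharacteristic Z)
    (hσ : IsCartanInvolution σ) (hσG : G.IsGradeReversing σ) {𝔞 : Submodule ℝ 𝔤}
    (h𝔞 : IsMaximalAbelianIn (cartanP σ) 𝔞) (h0 : 𝔞 ≤ G.deg 0) {H : 𝔤} (hH𝔞 : H ∈ 𝔞)
    (hH : (hσ.metric.restrict (G.extension 𝔞 h0 h𝔞.abelian)).IsMeanCurvatureVector
      ⟨H, G.subspace_le_extension _ _ hH𝔞⟩) : G.IsTraceDual H := by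
  have hκ := hσ.killingForm_nondegenerate
  obtain ⟨K, hK⟩ := G.exists_isTraceDual hκ
  have hKp : K ∈ cartanP σ := hK.apply_eq_neg hZ hσ hσG
  have hcomm : ∀ x ∈ 𝔞, ⁅x, K⁆ = 0 := fun x hx => hK.lie_eq_zero hκ (h0 hx)
  -- `K` lies in `𝔭` and commutes with `𝔞 ⊆ 𝔤_0`, so `𝔞 + ℝ K` is abelian and maximality applies.
  have hK𝔞 : K ∈ 𝔞 := by
    have hb : IsAbelianSubspace (𝔞 ⊔ Submodule.span ℝ {K}) := by
      intro x hx y hy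
      obtain ⟨a, ha, u, hu, rfl⟩ := Submodule.mem_sup.1 hx
      obtain ⟨b, hb, v, hv, rfl⟩ := Submodule.mem_sup.1 hy
      obtain ⟨s, rfl⟩ := Submodule.mem_span_singleton.1 hu
      obtain ⟨t, rfl⟩ := Submodule.mem_span_singleton.1 hv
      have hb' : ⁅K, b⁆ = 0 := by rw [← lie_skew, hcomm b hb, neg_zero]
      simp [h𝔞.abelian a ha b hb, hcomm a ha, hb']
    rw [← h𝔞.maximal _ (sup_le h𝔞.le ((Submodule.span_singleton_le_iff_mem _ _).2 hKp)) hb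
      le_sup_left]
    exact Submodule.mem_sup_right (Submodule.mem_span_singleton_self K)
  have hform : ∀ A ∈ 𝔞, hσ.metric.form H A = hσ.metric.form K A := by
    intro A hA
    have hneg : σ A = -A := h𝔞.le hA
    -- Brackets in `𝔞 + 𝔫` lie in `𝔫`, which is orthogonal to `𝔤_0`; thus every `A ∈ 𝔞` may be
    -- tested in the definition of the mean curvature vector.
    have h1 := hH.2 ⟨A, G.subspace_le_extension _ _ hA⟩ fun x y =>
      hZ.metric_eq_zero hσ hσG (h0 hA) (G.lie_mem_posPart_of_mem_extension h0 h𝔞.abelian x.2 y.2)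
    rw [trace_eq_trace_projPos (G := G) (F := LieAlgebra.ad ℝ 𝔤 A) le_sup_right, ← hK A] at h1
    · rw [hσ.metric_form K, hneg, map_neg, neg_neg, ← h1]
      rfl
    · intro x
      exact (G.projPos_eq_self (G.lie_mem_posPart_of_mem_extension h0 h𝔞.abelian
        (G.subspace_le_extension _ _ hA) x.2)).symm
  have : H - K = 0 := by
    by_contra hne
    refine (hσ.metric.posDef _ hne).ne' ?_
    rw [map_sub hσ.metric.form, LinearMap.sub_apply, hform _ (sub_mem hH𝔞 hK𝔞), sub_self]
  rwa [sub_eq_zero.1 this]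

/-! ### The Ricci form of the nilpotent part -/

theorem IsCharacteristic.nilMetric_compress (hZ : G.IsCharacteristic Z)
    (hσ : IsCartanInvolution σ) (hσG : G.IsGradeReversing σ) (F : 𝔤 →ₗ[ℝ] 𝔤) (u v : G.nilpart) :
    (G.nilMetric hσ).form (G.compress F u) v = hσ.metric.form (F u) v := by
  rw [nilMetric_form, coe_compress, hZ.metric_projPos hσ hσG, G.projPos_eq_self v.2]

theorem IsCharacteristic.trace_ad_nilpart (hZ : G.IsCharacteristic Z) (u : G.nilpart) :
    trace ℝ G.nilpart (LieAlgebra.ad ℝ G.nilpart u) = 0 := by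
  rw [trace_eq_trace_projPos (G := G) (F := LieAlgebra.ad ℝ 𝔤 u) le_rfl]
  · exact hZ.trace_ad_projOn_posPart _ u.2
  · exact fun x => (G.projPos_eq_self (G.lie_mem_posPart u.2 x.2)).symm

theorem IsCharacteristic.trace_ad_comp_ad_nilpart (hZ : G.IsCharacteristic Z) (u v : G.nilpart) :
    trace ℝ G.nilpart (LieAlgebra.ad ℝ G.nilpart u ∘ₗ LieAlgebra.ad ℝ G.nilpart v) = 0 := by
  rw [trace_eq_trace_projPos (G := G) (F := LieAlgebra.ad ℝ 𝔤 u ∘ₗ LieAlgebra.ad ℝ 𝔤 v) le_rfl]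
  · refine G.induction_posPart (p := fun x => trace ℝ 𝔤 ((LieAlgebra.ad ℝ 𝔤 x ∘ₗ
      LieAlgebra.ad ℝ 𝔤 (v : 𝔤)) ∘ₗ G.projPos) = 0)
      (fun l hl x hx => hZ.trace_ad_ad_projOn_posPart _ hl.le hx v.2) (fun y z hy hz => ?_) u.2
    rw [map_add, LinearMap.add_comp, LinearMap.add_comp, map_add, hy, hz, add_zero]
  · exact fun x =>
      (G.projPos_eq_self (G.lie_mem_posPart u.2 (G.lie_mem_posPart v.2 x.2))).symm

/-- On `𝔫` the adjoint of `ad u` is the compression of `-ad (σ u)`, and `J_u` is the compression of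
`-ad u ∘ σ`. The terms `tr (ad u ad v)` and `tr ad (∇_u v)` vanish by degree. -/
theorem IsCharacteristic.ricciForm_nilMetric (hZ : G.IsCharacteristic Z)
    (hσ : IsCartanInvolution σ) (hσG : G.IsGradeReversing σ) (u v : G.nilpart) :
    (G.nilMetric hσ).ricciForm u v =
      (1 / 2) * trace ℝ 𝔤 (LieAlgebra.ad ℝ 𝔤 (σ v) ∘ₗ LieAlgebra.ad ℝ 𝔤 (u : 𝔤) ∘ₗ G.projPos)
      - (1 / 4) * trace ℝ 𝔤 (LieAlgebra.ad ℝ 𝔤 (u : 𝔤) ∘ₗ G.projNeg ∘ₗ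
          LieAlgebra.ad ℝ 𝔤 (σ v) ∘ₗ G.projPos) := by
  have hT : ∀ u w z : G.nilpart,
      (G.nilMetric hσ).form (G.compress (-LieAlgebra.ad ℝ 𝔤 (σ u)) w) z =
        (G.nilMetric hσ).form w ⁅u, z⁆ := by
    intro u w z
    rw [hZ.nilMetric_compress hσ hσG, nilMetric_form, LinearMap.neg_apply, LieAlgebra.ad_apply,
      map_neg, LinearMap.neg_apply, hσ.metric_lie_left, hσ.involutive, neg_neg]
    rfl
  have hJ : ∀ u w z : G.nilpart,
      (G.nilMetric hσ).form (G.compress (-LieAlgebra.ad ℝ 𝔤 (u : 𝔤) ∘ₗ (σ : 𝔤 →ₗ[ℝ] 𝔤)) w) z =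
        (G.nilMetric hσ).form ⁅z, w⁆ u := by
    intro u w z
    rw [hZ.nilMetric_compress hσ hσG, nilMetric_form, ← lie_skew z w]
    have h1 := hσ.metric_lie_left (w : 𝔤) z u
    have h2 : ((-⁅w, z⁆ : G.nilpart) : 𝔤) = -⁅(w : 𝔤), (z : 𝔤)⁆ := rfl
    have h3 : hσ.metric.form (-⁅(w : 𝔤), (z : 𝔤)⁆) u = hσ.metric.form z ⁅σ (w : 𝔤), (u : 𝔤)⁆ := by
      rw [map_neg, LinearMap.neg_apply, h1, neg_neg]
    rw [h2, h3, hσ.metric.symm z, ← lie_skew (σ (w : 𝔤))]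
    rfl
  rw [LieMetric.ricciForm_eq_of_adjoint _ (hT u) (hT v) (hJ u) (hJ v),
    hZ.trace_ad_comp_ad_nilpart, hZ.trace_ad_nilpart,
    trace_eq_trace_projPos (G := G)
      (F := -(LieAlgebra.ad ℝ 𝔤 (σ v) ∘ₗ LieAlgebra.ad ℝ 𝔤 (u : 𝔤))) le_rfl,
    trace_eq_trace_projPos (G := G)
      (F := LieAlgebra.ad ℝ 𝔤 (u : 𝔤) ∘ₗ G.projNeg ∘ₗ LieAlgebra.ad ℝ 𝔤 (σ v)) le_rfl,
    LinearMap.neg_comp, map_neg]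
  · simp only [LinearMap.comp_assoc]
    ring
  · intro x
    simp only [LinearMap.comp_apply, coe_compress, LinearMap.neg_apply, LieAlgebra.ad_apply]
    -- In `J_u J_v`, moving `σ` past the inner `P` turns it into `M`, and the two occurrences of `σ`
    -- then cancel on `x`.
    change G.projPos (-⁅(u : 𝔤), σ (G.projPos (-⁅(v : 𝔤), σ (x : 𝔤)⁆))⁆) = _
    rw [hσG.apply_projPos, map_neg σ, LieEquiv.map_lie, hσ.involutive, map_neg, map_neg, lie_neg,
      map_neg, neg_neg]
  · intro x
    simp only [LinearMap.comp_apply, coe_compress, LinearMap.neg_apply, LieAlgebra.ad_apply]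
    rfl

theorem ricciForm_nilMetric_of_isTraceDual (hZ : G.IsCharacteristic Z)
    (hσ : IsCartanInvolution σ) (hσG : G.IsGradeReversing σ) (hH : G.IsTraceDual H)
    (u v : G.nilpart) :
    (G.nilMetric hσ).ricciForm u v = -(1 / 4) * (G.nilMetric hσ).form u v
      + (1 / 2) * (G.nilMetric hσ).form (G.compress (LieAlgebra.ad ℝ 𝔤 H) u) v := by
  -- Invariance moves the bracket to `B(H, [u, σ v])`, and trace duality applies to `Y = [u, σ v]`.
  have h1 : killingForm ℝ 𝔤 ⁅H, (u : 𝔤)⁆ (σ v) =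
      trace ℝ 𝔤 (LieAlgebra.ad ℝ 𝔤 (u : 𝔤) ∘ₗ LieAlgebra.ad ℝ 𝔤 (σ v) ∘ₗ G.projPos)
      - trace ℝ 𝔤 (LieAlgebra.ad ℝ 𝔤 (σ v) ∘ₗ LieAlgebra.ad ℝ 𝔤 (u : 𝔤) ∘ₗ G.projPos) := by
    rw [LieModule.traceForm_apply_lie_apply, hH, ← map_sub]
    congr 1
    ext x
    simp
  rw [hZ.ricciForm_nilMetric hσ hσG, hZ.nilMetric_compress hσ hσG, nilMetric_form, hσ.metric_form,
    hσ.metric_form, LieAlgebra.ad_apply, h1,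
    hZ.killingForm_eq_trace hσ.killingForm_nondegenerate u.2]
  ring

theorem IsTraceDual.trace_compress_ad (hH : G.IsTraceDual H) :
    trace ℝ G.nilpart (G.compress (LieAlgebra.ad ℝ 𝔤 H)) = killingForm ℝ 𝔤 H H := by
  rw [hH, trace_eq_trace_projPos (G := G) (F := LieAlgebra.ad ℝ 𝔤 H) le_rfl]
  exact fun x => rfl

theorem IsTraceDual.trace_compress_ad_comp_self (hH : G.IsTraceDual H)
    (hZ : G.IsCharacteristic Z) (hκ : (killingForm ℝ 𝔤).Nondegenerate) (hH0 : H ∈ G.deg 0) :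
    2 * trace ℝ G.nilpart
      (G.compress (LieAlgebra.ad ℝ 𝔤 H) ∘ₗ G.compress (LieAlgebra.ad ℝ 𝔤 H)) =
        killingForm ℝ 𝔤 H H := by
  rw [hH.killingForm_self hZ hκ, trace_eq_trace_projPos (G := G)
    (F := LieAlgebra.ad ℝ 𝔤 H ∘ₗ LieAlgebra.ad ℝ 𝔤 H) le_rfl]
  · rfl
  · intro x
    rw [LinearMap.comp_apply, coe_compress, coe_compress_ad hH0]
    rfl

theorem IsCharacteristic.trace_compress_ad_comp_ad (hZ : G.IsCharacteristic Z)
    (hH0 : H ∈ G.deg 0) (u : G.nilpart) :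
    trace ℝ G.nilpart
      (G.compress (LieAlgebra.ad ℝ 𝔤 H) ∘ₗ LieAlgebra.ad ℝ G.nilpart u) = 0 := by
  rw [trace_eq_trace_projPos (G := G) (F := LieAlgebra.ad ℝ 𝔤 H ∘ₗ LieAlgebra.ad ℝ 𝔤 (u : 𝔤))
    le_rfl]
  · exact hZ.trace_ad_ad_projOn_posPart _ le_rfl hH0 u.2
  · exact fun x => rfl

/-- The Ricci form of `ℝ H + 𝔫` restricted to `𝔫`. -/
theorem ricciForm_lineMetric_nilpart (hZ : G.IsCharacteristic Z) (hσ : IsCartanInvolution σ)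
    (hσG : G.IsGradeReversing σ) (hH0 : H ∈ G.deg 0) (hH : G.IsTraceDual H) (u v : G.nilpart) :
    (G.lineMetric hσ H hH0 2 two_pos).ricciForm
      (LieSubalgebra.inclusion (nilpart_le_lineExtension hH0) u)
      (LieSubalgebra.inclusion (nilpart_le_lineExtension hH0) v) =
      (G.nilMetric hσ).ricciForm u v
        - (1 / 2) * (G.nilMetric hσ).form (G.compress (LieAlgebra.ad ℝ 𝔤 H) u) v := by
  have hHσ := hH.apply_eq_neg hZ hσ hσG
  have E := G.isLineExtension_lineMetric hσ hH0 hHσ 2 two_pos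
  rw [E.ricciForm_map_map]
  by_cases h0 : killingForm ℝ 𝔤 H H = 0
  -- Degenerate case `H = 0`, where `D = 0`. Otherwise `tr D / |H|² = B(H, H) / (2 B(H, H))`, the
  -- source of the constant `½`.
  · rw [E.eq_zero_of_form_line (by rw [lineMetric_form_self hσ hH0 hHσ, h0, mul_zero]) u]
    simp
  · rw [hH.trace_compress_ad, lineMetric_form_self hσ hH0 hHσ]
    field_simp

/-- The metric Lie algebra `ℝ H + 𝔫` is Einstein. -/
theorem ricciForm_lineMetric (hZ : G.IsCharacteristic Z) (hσ : IsCartanInvolution σ)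
    (hσG : G.IsGradeReversing σ) (hH0 : H ∈ G.deg 0) (hH : G.IsTraceDual H)
    (x y : G.lineExtension H hH0) :
    (G.lineMetric hσ H hH0 2 two_pos).ricciForm x y =
      -(1 / 4) * (G.lineMetric hσ H hH0 2 two_pos).form x y := by
  have hκ := hσ.killingForm_nondegenerate
  have hHσ := hH.apply_eq_neg hZ hσ hσG
  have E := G.isLineExtension_lineMetric hσ hH0 hHσ 2 two_pos
  obtain ⟨s, u, rfl⟩ := E.exists_eq x
  obtain ⟨t, v, rfl⟩ := E.exists_eq y
  have h1 := hH.trace_compress_ad_comp_self hZ hκ hH0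
  -- With `B(H, H) = 2 tr D²`, the `H`-`H` entry reads `-tr D² = -¼ · 2 · (2 tr D²)`.
  have h2 : killingForm ℝ 𝔤 H H = _ := h1.symm
  simp only [map_add, map_smul, LinearMap.add_apply, LinearMap.smul_apply, smul_eq_mul,
    E.ricciForm_line_line, E.ricciForm_line_map, E.ricciForm_map_line, E.form_line,
    E.form_map_line, E.form_map, hZ.trace_compress_ad_comp_ad hH0, hZ.trace_ad_nilpart,
    ricciForm_lineMetric_nilpart hZ hσ hσG hH0 hH, lineMetric_form_self hσ hH0 hHσ,
    ricciForm_nilMetric_of_isTraceDual hZ hσ hσG hH, h2]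
  ring

/-- The Ricci operator of `ℝ H + 𝔫` on `𝔫`. -/
theorem ricci_lineMetric_nilpart (hZ : G.IsCharacteristic Z) (hσ : IsCartanInvolution σ)
    (hσG : G.IsGradeReversing σ) (hH0 : H ∈ G.deg 0) (hH : G.IsTraceDual H) (u : G.nilpart) :
    (G.lineMetric hσ H hH0 2 two_pos).ricci
      (LieSubalgebra.inclusion (nilpart_le_lineExtension hH0) u) =
      LieSubalgebra.inclusion (nilpart_le_lineExtension hH0)
        ((G.nilMetric hσ).ricci u - (1 / 2 : ℝ) • G.compress (LieAlgebra.ad ℝ 𝔤 H) u) := by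
  have hHσ := hH.apply_eq_neg hZ hσ hσG
  have E := G.isLineExtension_lineMetric hσ hH0 hHσ 2 two_pos
  refine E.eq_of_form ?_ fun v => ?_
  · rw [LieMetric.form_ricci, E.ricciForm_map_line, hZ.trace_ad_nilpart,
      hZ.trace_compress_ad_comp_ad hH0, E.form_map_line, sub_zero]
  · rw [LieMetric.form_ricci, ricciForm_lineMetric_nilpart hZ hσ hσG hH0 hH, E.form_map, map_sub,
      map_smul, LinearMap.sub_apply, LinearMap.smul_apply, LieMetric.form_ricci, smul_eq_mul]

end Finite

end LieGradation

theorem mainTheorem3 {𝔤 : Type*} [LieRing 𝔤] [LieAlgebra ℝ 𝔤] [Module.Finite ℝ 𝔤]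
    [LieAlgebra.IsSemisimple ℝ 𝔤]
    (G : LieGradation 𝔤) (Z : 𝔤) (hZ : G.IsCharacteristic Z)
    (σ : 𝔤 ≃ₗ⁅ℝ⁆ 𝔤) (hσ : IsCartanInvolution σ) (hσG : G.IsGradeReversing σ)
    (𝔞 : Submodule ℝ 𝔤) (h𝔞 : IsMaximalAbelianIn (cartanP σ) 𝔞) (hZ𝔞 : Z ∈ 𝔞)
    (H₀ : 𝔤) (hH₀𝔞 : H₀ ∈ 𝔞)
    (hH₀ : (hσ.metric.restrict (G.extension 𝔞 (G.le_deg_zero hZ h𝔞.abelian hZ𝔞)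
      h𝔞.abelian)).IsMeanCurvatureVector ⟨H₀, G.subspace_le_extension _ _ hH₀𝔞⟩) :
    have hH₀deg : H₀ ∈ G.deg 0 := G.le_deg_zero hZ h𝔞.abelian hZ𝔞 hH₀𝔞
    (∀ x : G.lineExtension H₀ hH₀deg,
      (x : 𝔤) ∈ Submodule.span ℝ {H₀} ⊔ G.deg 1 ⊔ G.deg 2 →
        (G.lineMetric hσ H₀ hH₀deg 2 two_pos).ricci x = -(1 / 4 : ℝ) • x) ∧
    (∀ U : G.nilpart,
      (((G.lineMetric hσ H₀ hH₀deg 2 two_pos).ricci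
          ⟨(U : 𝔤), G.posPart_le_extension _ _ U.2⟩ : G.lineExtension H₀ hH₀deg) : 𝔤) =
        (((G.nilMetric hσ).ricci U : G.nilpart) : 𝔤) - (1 / 2 : ℝ) • ⁅H₀, (U : 𝔤)⁆) := by
  intro hH₀deg
  have hH := LieGradation.isTraceDual_of_isMeanCurvatureVector hZ hσ hσG h𝔞 _ hH₀𝔞 hH₀
  refine ⟨fun x _ => ?_, fun U => ?_⟩
  · refine LieMetric.ext_form (G.lineMetric hσ H₀ hH₀deg 2 two_pos) fun y => ?_
    rw [LieMetric.form_ricci, LieGradation.ricciForm_lineMetric hZ hσ hσG hH₀deg hH, map_smul,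
      LinearMap.smul_apply, smul_eq_mul]
  · have h := congrArg Subtype.val
      (LieGradation.ricci_lineMetric_nilpart hZ hσ hσG hH₀deg hH U)
    refine h.trans ?_
    rw [← LieGradation.coe_compress_ad hH₀deg U]
    rfl
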